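/- Let $n\ge 10$ be an even integer and let $P$ be a set of $n$ points in the plane in regular wheel configuration: $n-1$ of the points are evenly spaced on a circle and the remaining point is the center of that circle. Let $K_n$ be the complete geometric graph on $P$, whose edges are the straight-line segments joining all pairs of points of $P$. Two different edges cross if their relative interiors have a common point. A 1-PHC (1-plane Hamiltonian cycle) on $P$ is a Hamiltonian cycle of $K_n$ each of whose edges is crossed by at most one other edge of the same cycle. Then the maximum number of pairwise edge-disjoint 1-PHCs contained in $K_n$ is exactly $\lfloor (n-1)/3\rfloor$: there exist $\lfloor (n-1)/3\rfloor$ pairwise edge-disjoint 1-PHCs on $P$, and no larger family of pairwise edge-disjoint 1-PHCs on $P$ exists. -/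

import Mathlib

/-! The Euclidean plane is modelled by `ℂ`, whose metric is the Euclidean one. A geometric graph on
a finite point set `P` is a `SimpleGraph P`, its edges being drawn as straight segments. -/

/-- `P` is a regular wheel configuration of `n` points: `n - 1` points evenly spaced on a circle
(with center `x` and radius `r > 0`), together with the center `x` of that circle. -/
def IsRegularWheel (n : ℕ) (P : Finset ℂ) : Prop :=
  P.card = n ∧ ∃ (x : ℂ) (r θ : ℝ), 0 < r ∧
    (P : Set ℂ) = insert x
      (Set.range fun k : Fin (n - 1) =>
        circleMap x r (θ + 2 * Real.pi * (k : ℝ) / ((n - 1 : ℕ) : ℝ)))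

/-- The relative interior of the straight segment drawn for an edge. -/
def edgeInterior {P : Finset ℂ} (e : Sym2 P) : Set ℂ :=
  Sym2.lift ⟨fun a b : P => openSegment ℝ (a : ℂ) (b : ℂ),
    fun a b => openSegment_symm ℝ (a : ℂ) (b : ℂ)⟩ e

/-- Two different edges cross if they have a common point in the interior of both. -/
def EdgesCross {P : Finset ℂ} (e f : Sym2 P) : Prop :=
  e ≠ f ∧ (edgeInterior e ∩ edgeInterior f).Nonempty

/-- A geometric graph is 1-plane if each of its edges is crossed by at most one of its edges. -/
def IsOnePlane {P : Finset ℂ} (G : SimpleGraph P) : Prop :=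
  ∀ e ∈ G.edgeSet, {f | f ∈ G.edgeSet ∧ EdgesCross e f}.encard ≤ 1

/-- `G` consists of exactly the edges of some Hamiltonian cycle of the complete graph on `P`. -/
def IsHamCycleGraph {P : Finset ℂ} (G : SimpleGraph P) : Prop :=
  ∃ (v : P) (w : (⊤ : SimpleGraph P).Walk v v),
    w.IsHamiltonianCycle ∧ G.edgeSet = {e | e ∈ w.edges}

/-- A 1-plane Hamiltonian cycle (1-PHC) on the point set `P`. -/
def IsOnePHC {P : Finset ℂ} (G : SimpleGraph P) : Prop :=
  IsHamCycleGraph G ∧ IsOnePlane G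

/-- The complete geometric graph on `P` contains `k` pairwise edge-disjoint 1-PHCs. -/
def HasOnePHCPacking (P : Finset ℂ) (k : ℕ) : Prop :=
  ∃ C : Fin k → SimpleGraph P, (∀ i, IsOnePHC (C i)) ∧
    ∀ i j, i ≠ j → Disjoint (C i).edgeSet (C j).edgeSet

/-! Write `m = n - 1`, which is odd and at least 9. The upper bound is a double count of `2 * m`
units arranged cyclically around the rim: the `m` boundary edges and the `m` rim vertices, a vertex
being credited to a cycle that contains two of the three edges of the triangle on it and its two rim
neighbours. Edge-disjoint cycles share no unit (`IsRimUnit.not_disjoint`), and every 1-PHC has at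
least six (`hasSixUnits`), so `k` disjoint cycles give `6 * k ≤ 2 * m`.

For the six units, a chord of the cycle cuts the rim into two arcs, and each contains an arc closed
off by a chord with no further chord inside. The cycle must leave this arc, but 1-planarity lets
only one edge cross the closing chord, and at most two spokes end inside. Hence the cycle mostly
follows the boundary there, which yields three consecutive units on each side (`run_or_spokeEnd`).
The exception is a three-point arc whose middle point is joined to the center; that case is a
separate analysis of the whole cycle (`sixUnits_of_spokeEnd_zero`). If there is no chord at all,
only the two spokes interrupt the boundary.

For the lower bound, take a zigzag Hamiltonian cycle on the rim and replace one suitable edge by a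
detour through the center. Its chords occupy three consecutive parallel classes, that is, three
consecutive values modulo `m` of the sum of the end positions. Rotations that shift these classes by
multiples of three are edge-disjoint.

All geometry is condensed into `IsWheelLabelling`, which says exactly which edges cross; oddness of
`m` keeps the center off every chord. -/

/-! ### Orientation and crossing of segments -/

/-- Twice the signed area of the triangle `A B C`. -/
def signedArea (A B C : ℂ) : ℝ :=
  (B.re - A.re) * (C.im - A.im) - (B.im - A.im) * (C.re - A.re)

theorem signedArea_rotate (A B C : ℂ) : signedArea A B C = signedArea B C A := by
  unfold signedArea; ring

theorem signedArea_right_self (A B : ℂ) : signedArea A B B = 0 := by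
  unfold signedArea; ring

theorem signedArea_left_self (A B : ℂ) : signedArea A B A = 0 := by
  unfold signedArea; ring

theorem signedArea_combo (A B C D : ℂ) (s t : ℝ) (hst : s + t = 1) :
    signedArea A B (s • C + t • D) = s * signedArea A B C + t * signedArea A B D := by
  unfold signedArea
  have hs : s = 1 - t := by linarith
  subst hs
  simp
  ring

theorem openSegments_inter {A B C D : ℂ}
    (hC : signedArea A B C < 0) (hD : 0 < signedArea A B D)
    (hA : 0 < signedArea C D A) (hB : signedArea C D B < 0) :
    (openSegment ℝ A B ∩ openSegment ℝ C D).Nonempty := by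
  set p := signedArea A B D with hp
  set q := - signedArea A B C with hq
  set u := signedArea C D A with hu
  set v := - signedArea C D B with hv
  have hq0 : 0 < q := by linarith
  have hv0 : 0 < v := by linarith
  have hs : p + q = u + v := by
    rw [hp, hq, hu, hv]; unfold signedArea; ring
  have hpq : 0 < p + q := by linarith
  -- The common point divides each segment in the ratio of the distances of its ends from the other
  -- line. The common denominator `p + q = u + v` is twice the area of the quadrilateral with
  -- diagonals `A B` and `C D`.
  refine ⟨(p / (p + q)) • C + (q / (p + q)) • D, ?_,
    ⟨p / (p + q), q / (p + q), by positivity, by positivity, by field_simp, rfl⟩⟩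
  refine ⟨v / (p + q), u / (p + q), by positivity, by positivity, ?_, ?_⟩
  · field_simp; linarith
  · apply Complex.ext
    · simp only [Complex.add_re, Complex.real_smul, Complex.mul_re, Complex.ofReal_re,
        Complex.ofReal_im, zero_mul, sub_zero]
      field_simp
      rw [hp, hq, hu, hv]; unfold signedArea; ring
    · simp only [Complex.add_im, Complex.real_smul, Complex.mul_im, Complex.ofReal_re,
        Complex.ofReal_im, zero_mul, add_zero]
      field_simp
      rw [hp, hq, hu, hv]; unfold signedArea; ring

theorem signedArea_of_mem_openSegment {A B z : ℂ} (hz : z ∈ openSegment ℝ A B) :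
    signedArea A B z = 0 := by
  obtain ⟨s, t, -, -, hst, rfl⟩ := hz
  rw [signedArea_combo _ _ _ _ _ _ hst, signedArea_left_self, signedArea_right_self]; ring

/-- The signed area over `A B` is affine in the third point, so it is strictly positive on the open
segment `C D`, while it vanishes on `A B`. -/
theorem not_inter_of_nonneg {A B C D : ℂ} (hC : 0 ≤ signedArea A B C)
    (hD : 0 ≤ signedArea A B D) (h : signedArea A B C ≠ 0 ∨ signedArea A B D ≠ 0) :
    ¬ (openSegment ℝ A B ∩ openSegment ℝ C D).Nonempty := by
  rintro ⟨z, hz, s, t, hs, ht, hst, rfl⟩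
  have h0 := signedArea_of_mem_openSegment hz
  rw [signedArea_combo _ _ _ _ _ _ hst] at h0
  have h1 := mul_nonneg hs.le hC
  have h2 := mul_nonneg ht.le hD
  rcases h with h | h
  · exact (mul_ne_zero hs.ne' h) (by linarith)
  · exact (mul_ne_zero ht.ne' h) (by linarith)

theorem not_inter_of_nonpos {A B C D : ℂ} (hC : signedArea A B C ≤ 0)
    (hD : signedArea A B D ≤ 0) (h : signedArea A B C ≠ 0 ∨ signedArea A B D ≠ 0) :
    ¬ (openSegment ℝ A B ∩ openSegment ℝ C D).Nonempty := by
  rintro ⟨z, hz, s, t, hs, ht, hst, rfl⟩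
  have h0 := signedArea_of_mem_openSegment hz
  rw [signedArea_combo _ _ _ _ _ _ hst] at h0
  have h1 := mul_nonneg hs.le (neg_nonneg.2 hC)
  have h2 := mul_nonneg ht.le (neg_nonneg.2 hD)
  rcases h with h | h
  · exact (mul_ne_zero hs.ne' h) (by linarith)
  · exact (mul_ne_zero ht.ne' h) (by linarith)

/-! ### Coordinates and orientations of the wheel points -/

/-- The rim point number `k` of a regular wheel with `m` rim points. -/
noncomputable def rimPoint (x : ℂ) (r θ : ℝ) (m k : ℤ) : ℂ :=
  circleMap x r (θ + 2 * Real.pi * k / m)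

theorem rimPoint_re (x : ℂ) (r θ : ℝ) (m k : ℤ) :
    (rimPoint x r θ m k).re = x.re + r * Real.cos (θ + 2 * Real.pi * k / m) := by
  simp [rimPoint, circleMap, Complex.exp_re]

theorem rimPoint_im (x : ℂ) (r θ : ℝ) (m k : ℤ) :
    (rimPoint x r θ m k).im = x.im + r * Real.sin (θ + 2 * Real.pi * k / m) := by
  simp [rimPoint, circleMap, Complex.exp_im]

theorem rimPoint_add_mul (x : ℂ) (r θ : ℝ) {m : ℤ} (hm : 0 < m) (k j : ℤ) :
    rimPoint x r θ m (k + m * j) = rimPoint x r θ m k := by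
  have hm' : (m : ℝ) ≠ 0 := by exact_mod_cast hm.ne'
  have : θ + 2 * Real.pi * ((k + m * j : ℤ) : ℝ) / m
      = θ + 2 * Real.pi * k / m + j * (2 * Real.pi) := by
    push_cast; field_simp; ring
  unfold rimPoint
  rw [this]
  apply Complex.ext <;>
    simp [circleMap, Complex.exp_re, Complex.exp_im, -Complex.ofReal_add, -Complex.ofReal_mul,
      Real.cos_add_int_mul_two_pi, Real.sin_add_int_mul_two_pi]

/-- An inscribed triangle has area `abc / (4R)` and its sides are `2R` times the sines of half the
central angles; this is the signed form for `R = 1`. -/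
theorem triangle_area_identity (φ α β : ℝ) :
    (Real.cos (φ + 2 * α) - Real.cos φ) * (Real.sin (φ + 2 * (α + β)) - Real.sin φ) -
      (Real.sin (φ + 2 * α) - Real.sin φ) * (Real.cos (φ + 2 * (α + β)) - Real.cos φ) =
      4 * Real.sin α * Real.sin β * Real.sin (α + β) := by
  have h1 : Real.cos (φ + 2 * α) - Real.cos φ = -2 * Real.sin (φ + α) * Real.sin α := by
    rw [Real.cos_sub_cos]; ring_nf
  have h2 : Real.sin (φ + 2 * α) - Real.sin φ = 2 * Real.sin α * Real.cos (φ + α) := by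
    rw [Real.sin_sub_sin]; ring_nf
  have h3 : Real.cos (φ + 2 * (α + β)) - Real.cos φ =
      -2 * Real.sin (φ + (α + β)) * Real.sin (α + β) := by
    rw [Real.cos_sub_cos]; ring_nf
  have h4 : Real.sin (φ + 2 * (α + β)) - Real.sin φ =
      2 * Real.sin (α + β) * Real.cos (φ + (α + β)) := by
    rw [Real.sin_sub_sin]; ring_nf
  have h5 : Real.sin β = Real.sin (φ + (α + β)) * Real.cos (φ + α) -
      Real.cos (φ + (α + β)) * Real.sin (φ + α) := by
    rw [← Real.sin_sub]; ring_nf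
  rw [h1, h2, h3, h4, h5]
  ring

theorem signedArea_rimPoints (x : ℂ) (r θ : ℝ) (m a b k : ℤ) :
    signedArea (rimPoint x r θ m a) (rimPoint x r θ m b) (rimPoint x r θ m k) =
      4 * r ^ 2 * Real.sin (Real.pi * (b - a : ℤ) / m) * Real.sin (Real.pi * (k - b : ℤ) / m) *
        Real.sin (Real.pi * (k - a : ℤ) / m) := by
  unfold signedArea
  simp only [rimPoint_re, rimPoint_im]
  have h1 : θ + 2 * Real.pi * b / m =
      θ + 2 * Real.pi * a / m + 2 * (Real.pi * (b - a : ℤ) / m) := by push_cast; ring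
  have h3 : Real.pi * (k - a : ℤ) / m =
      Real.pi * (b - a : ℤ) / m + Real.pi * (k - b : ℤ) / m := by push_cast; ring
  have h2 : θ + 2 * Real.pi * k / m =
      θ + 2 * Real.pi * a / m + 2 * (Real.pi * (b - a : ℤ) / m + Real.pi * (k - b : ℤ) / m) := by
    push_cast; ring
  rw [h3, h1, h2]
  linear_combination r ^ 2 * triangle_area_identity (θ + 2 * Real.pi * a / m)
    (Real.pi * (b - a : ℤ) / m) (Real.pi * (k - b : ℤ) / m)

theorem signedArea_center (x : ℂ) (r θ : ℝ) (m a b : ℤ) :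
    signedArea x (rimPoint x r θ m a) (rimPoint x r θ m b) =
      r ^ 2 * Real.sin (Real.pi * (2 * (b - a) : ℤ) / m) := by
  unfold signedArea
  simp only [rimPoint_re, rimPoint_im]
  have h : Real.pi * (2 * (b - a) : ℤ) / m =
      (θ + 2 * Real.pi * b / m) - (θ + 2 * Real.pi * a / m) := by push_cast; ring
  rw [h, Real.sin_sub]
  ring

theorem sin_pi_mul_div_pos {m d : ℤ} (h0 : 0 < d) (h1 : d < m) :
    0 < Real.sin (Real.pi * (d : ℝ) / m) := by
  have hm : (0 : ℝ) < m := by exact_mod_cast h0.trans h1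
  have hd : (0 : ℝ) < d := by exact_mod_cast h0
  have hdm : (d : ℝ) < m := by exact_mod_cast h1
  apply Real.sin_pos_of_pos_of_lt_pi
  · positivity
  · rw [div_lt_iff₀ hm]; exact mul_lt_mul_of_pos_left hdm Real.pi_pos

theorem sin_pi_mul_div_neg {m d : ℤ} (h0 : d < 0) (h1 : -m < d) :
    Real.sin (Real.pi * (d : ℝ) / m) < 0 := by
  have h := sin_pi_mul_div_pos (m := m) (d := -d) (by omega) (by omega)
  have e : Real.pi * ((-d : ℤ) : ℝ) / m = -(Real.pi * (d : ℝ) / m) := by push_cast; ring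
  rw [e, Real.sin_neg] at h
  linarith

theorem sin_pi_mul_div_neg' {m d : ℤ} (hm : 0 < m) (h0 : m < d) (h1 : d < 2 * m) :
    Real.sin (Real.pi * (d : ℝ) / m) < 0 := by
  have h := sin_pi_mul_div_pos (m := m) (d := d - m) (by omega) (by omega)
  have hm' : (m : ℝ) ≠ 0 := by exact_mod_cast hm.ne'
  have e : Real.pi * ((d - m : ℤ) : ℝ) / m = Real.pi * (d : ℝ) / m - Real.pi := by
    push_cast; field_simp
  rw [e, Real.sin_sub_pi] at h
  linarith

section Rim

variable {x : ℂ} {r θ : ℝ} {m : ℤ}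

theorem signedArea_rim_neg (hr : 0 < r) {a b k : ℤ} (h1 : a < k) (h2 : k < b) (h3 : b < a + m) :
    signedArea (rimPoint x r θ m a) (rimPoint x r θ m b) (rimPoint x r θ m k) < 0 := by
  rw [signedArea_rimPoints]
  have e1 := sin_pi_mul_div_pos (m := m) (d := b - a) (by omega) (by omega)
  have e2 := sin_pi_mul_div_neg (m := m) (d := k - b) (by omega) (by omega)
  have e3 := sin_pi_mul_div_pos (m := m) (d := k - a) (by omega) (by omega)
  exact mul_neg_of_neg_of_pos (mul_neg_of_pos_of_neg (by positivity) e2) e3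

theorem signedArea_rim_pos_right (hr : 0 < r) {a b k : ℤ} (h1 : a < b) (h2 : b < k)
    (h3 : k < a + m) :
    0 < signedArea (rimPoint x r θ m a) (rimPoint x r θ m b) (rimPoint x r θ m k) := by
  rw [signedArea_rimPoints]
  have e1 := sin_pi_mul_div_pos (m := m) (d := b - a) (by omega) (by omega)
  have e2 := sin_pi_mul_div_pos (m := m) (d := k - b) (by omega) (by omega)
  have e3 := sin_pi_mul_div_pos (m := m) (d := k - a) (by omega) (by omega)
  positivity

theorem signedArea_rim_pos_left (hr : 0 < r) {a b k : ℤ} (h1 : a < b) (h2 : k < a)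
    (h3 : b < k + m) :
    0 < signedArea (rimPoint x r θ m a) (rimPoint x r θ m b) (rimPoint x r θ m k) := by
  rw [← signedArea_rotate]
  exact signedArea_rim_pos_right hr h2 h1 h3

/-- The side of the line through two rim points on which a third rim point lies. -/
theorem signedArea_rim_cases (hr : 0 < r) {a b k w : ℤ} (ha : w ≤ a) (hab : a < b)
    (hb : b < w + m) (hk : w ≤ k) (hk' : k < w + m) :
    (a < k ∧ k < b ∧
      signedArea (rimPoint x r θ m a) (rimPoint x r θ m b) (rimPoint x r θ m k) < 0) ∨
    ((k < a ∨ b < k) ∧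
      0 < signedArea (rimPoint x r θ m a) (rimPoint x r θ m b) (rimPoint x r θ m k)) ∨
    ((k = a ∨ k = b) ∧
      signedArea (rimPoint x r θ m a) (rimPoint x r θ m b) (rimPoint x r θ m k) = 0) := by
  rcases lt_trichotomy k a with h | h | h
  · exact Or.inr (Or.inl ⟨Or.inl h, signedArea_rim_pos_left hr hab h (by omega)⟩)
  · subst h; exact Or.inr (Or.inr ⟨Or.inl rfl, signedArea_left_self _ _⟩)
  · rcases lt_trichotomy k b with h' | h' | h'
    · exact Or.inl ⟨h, h', signedArea_rim_neg hr h h' (by omega)⟩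
    · subst h'; exact Or.inr (Or.inr ⟨Or.inr rfl, signedArea_right_self _ _⟩)
    · exact Or.inr (Or.inl ⟨Or.inr h', signedArea_rim_pos_right hr hab h' (by omega)⟩)

theorem signedArea_center_pos (hr : 0 < r) {a b : ℤ} (h1 : a < b) (h2 : 2 * (b - a) < m) :
    0 < signedArea x (rimPoint x r θ m a) (rimPoint x r θ m b) := by
  rw [signedArea_center]
  have := sin_pi_mul_div_pos (m := m) (d := 2 * (b - a)) (by omega) (by omega)
  positivity

theorem signedArea_center_neg (hr : 0 < r) {a b : ℤ} (h1 : b < a + m) (h2 : m < 2 * (b - a)) :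
    signedArea x (rimPoint x r θ m a) (rimPoint x r θ m b) < 0 := by
  rw [signedArea_center]
  have := sin_pi_mul_div_neg' (m := m) (d := 2 * (b - a)) (by omega) (by omega) (by omega)
  exact mul_neg_of_pos_of_neg (by positivity) this

theorem signedArea_center_neg_of_gt (hr : 0 < r) {a b : ℤ} (h1 : b < a) (h2 : 2 * (a - b) < m) :
    signedArea x (rimPoint x r θ m a) (rimPoint x r θ m b) < 0 := by
  rw [signedArea_center]
  have := sin_pi_mul_div_neg (m := m) (d := 2 * (b - a)) (by omega) (by omega)
  exact mul_neg_of_pos_of_neg (by positivity) this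

end Rim

/-! ### Combinatorial model of the wheel -/

/-- `c` is the center and `f` is the periodic enumeration of the rim points of a wheel
configuration with an odd number `m` of rim points. -/
structure IsWheelLabelling (m : ℤ) {P : Finset ℂ} (c : P) (f : ℤ → P) : Prop where
  pos : 0 < m
  odd : Odd m
  eq_iff : ∀ a b, f a = f b ↔ m ∣ a - b
  ne_center : ∀ a, f a ≠ c
  eq_center_or : ∀ v, v = c ∨ ∃ a, v = f a
  chord_cross : ∀ a b x y, a < x → x < b → b < y → y < a + m →
    EdgesCross s(f a, f b) s(f x, f y)
  spoke_cross : ∀ a b x, a < x → x < b → 2 * (b - a) < m → EdgesCross s(f a, f b) s(c, f x)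
  of_chord_cross : ∀ w a b x y, w ≤ a → a < b → b < w + m → w ≤ x → x < y → y < w + m →
    EdgesCross s(f a, f b) s(f x, f y) → (a < x ∧ x < b ∧ b < y) ∨ (x < a ∧ a < y ∧ y < b)
  of_spoke_cross : ∀ w a b x, w ≤ a → a < b → b < w + m → w ≤ x → x < w + m →
    EdgesCross s(f a, f b) s(c, f x) →
    (a < x ∧ x < b ∧ 2 * (b - a) < m) ∨ ((x < a ∨ b < x) ∧ m < 2 * (b - a))
  not_spokes_cross : ∀ a b, ¬ EdgesCross s(c, f a) s(c, f b)

theorem EdgesCross.symm {P : Finset ℂ} {e f : Sym2 P} (h : EdgesCross e f) : EdgesCross f e :=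
  ⟨h.1.symm, by rw [Set.inter_comm]; exact h.2⟩

theorem rimPoint_eq_iff {x : ℂ} {r θ : ℝ} (hr : 0 < r) {m : ℤ} (hm : 0 < m) (a b : ℤ) :
    rimPoint x r θ m a = rimPoint x r θ m b ↔ m ∣ a - b := by
  constructor
  · intro h
    have h1 := congrArg Complex.re h
    have h2 := congrArg Complex.im h
    rw [rimPoint_re, rimPoint_re] at h1
    rw [rimPoint_im, rimPoint_im] at h2
    have h3 := mul_left_cancel₀ hr.ne' (add_left_cancel h1)
    have h4 := mul_left_cancel₀ hr.ne' (add_left_cancel h2)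
    have h5 : Real.cos ((θ + 2 * Real.pi * a / m) - (θ + 2 * Real.pi * b / m)) = 1 := by
      rw [Real.cos_sub, h3, h4, ← Real.cos_sq_add_sin_sq (θ + 2 * Real.pi * b / m)]; ring
    obtain ⟨k, hk⟩ := (Real.cos_eq_one_iff _).1 h5
    refine ⟨k, ?_⟩
    have hm' : (m : ℝ) ≠ 0 := by exact_mod_cast hm.ne'
    have hpi := Real.pi_ne_zero
    have h6 : ((a - b : ℤ) : ℝ) = ((m * k : ℤ) : ℝ) := by
      push_cast
      have e : (k : ℝ) * (2 * Real.pi) = 2 * Real.pi * ((a - b) / m) := by rw [hk]; ring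
      have e' : (k : ℝ) = (a - b) / m :=
        mul_left_cancel₀ (mul_ne_zero two_ne_zero hpi) (by linarith)
      rw [e']; field_simp
    exact_mod_cast h6
  · rintro ⟨k, hk⟩
    have : a = b + m * k := by linarith
    rw [this, rimPoint_add_mul x r θ hm]

theorem rimPoint_ne_center {x : ℂ} {r θ : ℝ} (hr : 0 < r) (m a : ℤ) :
    rimPoint x r θ m a ≠ x :=
  circleMap_ne_center hr.ne'

theorem isWheelLabelling_rimPoint {P : Finset ℂ} {x : ℂ} {r θ : ℝ} (hr : 0 < r) {m : ℤ}
    (hm : 0 < m) (hodd : Odd m) (hx : x ∈ P) (hrim : ∀ k, rimPoint x r θ m k ∈ P)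
    (hP : ∀ z ∈ P, z = x ∨ ∃ k, z = rimPoint x r θ m k) :
    IsWheelLabelling m (⟨x, hx⟩ : P) (fun k => ⟨rimPoint x r θ m k, hrim k⟩) where
  pos := hm
  odd := hodd
  eq_iff a b := by rw [Subtype.mk.injEq, rimPoint_eq_iff hr hm]
  ne_center a h := rimPoint_ne_center hr m a (Subtype.mk.inj h)
  eq_center_or := by
    rintro ⟨z, hz⟩
    simpa using hP z hz
  chord_cross a b x' y h1 h2 h3 h4 := by
    refine ⟨?_, ?_⟩
    · rw [Ne, Sym2.eq_iff]
      simp only [Subtype.mk.injEq, rimPoint_eq_iff hr hm]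
      rintro (⟨⟨k, hk⟩, -⟩ | ⟨⟨k, hk⟩, -⟩)
      · have : k < 0 := by nlinarith
        have : -1 < k := by nlinarith
        omega
      · have : k < 0 := by nlinarith
        have : -1 < k := by nlinarith
        omega
    · exact openSegments_inter (signedArea_rim_neg hr h1 h2 (by omega))
        (signedArea_rim_pos_right hr (by omega) h3 h4)
        (signedArea_rim_pos_left hr (by omega) h1 h4)
        (signedArea_rim_neg hr h2 h3 (by omega))
  spoke_cross a b x' h1 h2 h3 := by
    refine ⟨?_, ?_⟩
    · rw [Ne, Sym2.eq_iff]
      simp only [Subtype.mk.injEq]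
      rintro (⟨h, -⟩ | ⟨-, h⟩) <;> exact rimPoint_ne_center hr _ _ h
    · show (openSegment ℝ (rimPoint x r θ m a) (rimPoint x r θ m b) ∩
        openSegment ℝ x (rimPoint x r θ m x')).Nonempty
      rw [openSegment_symm ℝ x]
      refine openSegments_inter (signedArea_rim_neg hr h1 h2 (by omega)) ?_ ?_ ?_
      · rw [← signedArea_rotate]; exact signedArea_center_pos hr (by omega) h3
      · rw [signedArea_rotate]; exact signedArea_center_pos hr h1 (by omega)
      · rw [signedArea_rotate]; exact signedArea_center_neg_of_gt hr h2 (by omega)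
  of_chord_cross w a b x' y h1 h2 h3 h4 h5 h6 h := by
    obtain ⟨hne, h⟩ := h
    by_contra hcon
    have hne' : ¬ (x' = a ∧ y = b) := by
      rintro ⟨rfl, rfl⟩; exact hne rfl
    rcases signedArea_rim_cases (x := x) (θ := θ) hr h1 h2 h3 h4 (by omega : x' < w + m) with
      ⟨p1, p2, p3⟩ | ⟨p1, p3⟩ | ⟨p1, p3⟩ <;>
    rcases signedArea_rim_cases (x := x) (θ := θ) hr h1 h2 h3 (by omega : w ≤ y) h6 with
      ⟨q1, q2, q3⟩ | ⟨q1, q3⟩ | ⟨q1, q3⟩ <;>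
    first
      | omega
      | exact not_inter_of_nonneg (by linarith) (by linarith) (Or.inl p3.ne') h
      | exact not_inter_of_nonpos (by linarith) (by linarith) (Or.inl p3.ne) h
      | exact not_inter_of_nonneg (by linarith) (by linarith) (Or.inr q3.ne') h
      | exact not_inter_of_nonpos (by linarith) (by linarith) (Or.inr q3.ne) h
  of_spoke_cross w a b x' h1 h2 h3 h4 h5 h := by
    obtain ⟨-, h⟩ := h
    replace h : (openSegment ℝ (rimPoint x r θ m a) (rimPoint x r θ m b) ∩
        openSegment ℝ x (rimPoint x r θ m x')).Nonempty := h
    by_contra hcon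
    have hc := signedArea_rotate x (rimPoint x r θ m a) (rimPoint x r θ m b)
    have hlen : 2 * (b - a) < m ∨ m < 2 * (b - a) := by
      rcases hodd with ⟨k, hk⟩; omega
    rcases signedArea_rim_cases (x := x) (θ := θ) hr h1 h2 h3 h4 h5 with
      ⟨p1, p2, p3⟩ | ⟨p1, p3⟩ | ⟨p1, p3⟩ <;>
    rcases hlen with hl | hl <;>
    first
      | omega
      | exact not_inter_of_nonneg
          (by have := signedArea_center_pos (x := x) (θ := θ) hr h2 hl; linarith)
          (by linarith)
          (Or.inl (by have := signedArea_center_pos (x := x) (θ := θ) hr h2 hl; linarith)) h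
      | exact not_inter_of_nonpos
          (by have := signedArea_center_neg (x := x) (r := r) (θ := θ) hr (by omega) hl; linarith)
          (by linarith)
          (Or.inl (by
            have := signedArea_center_neg (x := x) (r := r) (θ := θ) hr (by omega) hl
            rw [← hc]; exact this.ne)) h
  not_spokes_cross a b h := by
    obtain ⟨hne, h⟩ := h
    have hab : ¬ m ∣ b - a := by
      intro hd
      apply hne
      have := (rimPoint_eq_iff (x := x) (θ := θ) hr hm b a).2 hd
      simp [this]
    have h0 : signedArea x (rimPoint x r θ m a) (rimPoint x r θ m b) ≠ 0 := by
      rw [signedArea_center]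
      refine mul_ne_zero (by positivity) ?_
      rw [Ne, Real.sin_eq_zero_iff]
      rintro ⟨k, hk⟩
      have hm' : (m : ℝ) ≠ 0 := by exact_mod_cast hm.ne'
      have hpi := Real.pi_ne_zero
      rw [eq_div_iff hm'] at hk
      have h2 : ((k * m : ℤ) : ℝ) = ((2 * (b - a) : ℤ) : ℝ) := by
        have : Real.pi * (k * m : ℝ) = Real.pi * ((2 * (b - a) : ℤ) : ℝ) := by linarith
        rw [← mul_left_cancel₀ hpi this]; push_cast; ring
      have h3 : k * m = 2 * (b - a) := by exact_mod_cast h2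
      have h4 : m ∣ 2 * (b - a) := ⟨k, by linarith⟩
      -- Oddness excludes antipodal rim points, so two distinct spokes are never collinear.
      have h5 : IsCoprime m 2 := by
        rcases hodd with ⟨j, hj⟩; exact ⟨1, -j, by rw [hj]; ring⟩
      exact hab (h5.dvd_of_dvd_mul_left h4)
    replace h : (openSegment ℝ x (rimPoint x r θ m a) ∩
        openSegment ℝ x (rimPoint x r θ m b)).Nonempty := h
    have h1 := signedArea_left_self x (rimPoint x r θ m a)
    rcases lt_or_gt_of_ne h0 with h2 | h2
    · exact not_inter_of_nonpos h1.le h2.le (Or.inr h0) h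
    · exact not_inter_of_nonneg h1.ge h2.le (Or.inr h0) h

theorem IsRegularWheel.exists_labelling {n : ℕ} {P : Finset ℂ} (hn : 2 ≤ n) (heven : Even n)
    (hP : IsRegularWheel n P) :
    ∃ (c : P) (f : ℤ → P), IsWheelLabelling (n - 1 : ℤ) c f := by
  obtain ⟨-, x, r, θ, hr, hset⟩ := hP
  have hm : (0 : ℤ) < (n - 1 : ℤ) := by omega
  have hodd : Odd (n - 1 : ℤ) := by
    obtain ⟨k, hk⟩ := heven
    exact ⟨k - 1, by omega⟩
  have hcast : (((n - 1 : ℕ) : ℝ)) = (((n : ℤ) - 1 : ℤ) : ℝ) := by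
    rw [Nat.cast_sub (by omega)]; push_cast; ring
  have hpt : ∀ k : Fin (n - 1), circleMap x r (θ + 2 * Real.pi * (k : ℝ) / ((n - 1 : ℕ) : ℝ)) =
      rimPoint x r θ (n - 1 : ℤ) ((k : ℕ) : ℤ) := by
    intro k
    rw [hcast]; simp [rimPoint]
  have hmem : ∀ z, z ∈ P ↔ z = x ∨
      ∃ k : Fin (n - 1), z = rimPoint x r θ (n - 1 : ℤ) ((k : ℕ) : ℤ) := by
    intro z
    rw [← Finset.mem_coe, hset]
    simp only [Set.mem_insert_iff, Set.mem_range, hpt]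
    simp only [eq_comm]
  have hrim : ∀ k : ℤ, rimPoint x r θ (n - 1 : ℤ) k ∈ P := by
    intro k
    refine (hmem _).2 (Or.inr ⟨⟨(k % (n - 1 : ℤ)).toNat, ?_⟩, ?_⟩)
    · have h1 := Int.emod_lt_of_pos k hm
      have h2 := Int.emod_nonneg k hm.ne'
      omega
    · rw [rimPoint_eq_iff hr hm]
      have h2 := Int.emod_nonneg k hm.ne'
      simp only [Int.toNat_of_nonneg h2]
      exact Int.dvd_self_sub_emod
  exact ⟨_, _, isWheelLabelling_rimPoint hr hm hodd ((hmem x).2 (Or.inl rfl)) hrim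
    fun z hz => ((hmem z).1 hz).imp_right fun ⟨k, hk⟩ => ⟨_, hk⟩⟩

/-! ### Degrees and cuts of Hamiltonian cycles -/

theorem IsHamCycleGraph.exists_adj_iff {P : Finset ℂ} {G : SimpleGraph P}
    (hG : IsHamCycleGraph G) (v : P) : ∃ x y, x ≠ y ∧ ∀ z, G.Adj v z ↔ z = x ∨ z = y := by
  obtain ⟨a, w, hw, hE⟩ := hG
  have hadj : ∀ z, G.Adj v z ↔ z ∈ w.toSubgraph.neighborSet v := by
    intro z
    rw [← SimpleGraph.mem_edgeSet, hE, SimpleGraph.Subgraph.mem_neighborSet,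
      SimpleGraph.Walk.adj_toSubgraph_iff_mem_edges]
    rfl
  have h2 := hw.isCycle.ncard_neighborSet_toSubgraph_eq_two (hw.mem_support v)
  obtain ⟨x, y, hxy, hs⟩ := Set.ncard_eq_two.1 h2
  refine ⟨x, y, hxy, fun z => ?_⟩
  rw [hadj, hs]; simp

/-- Deleting one vertex from a cycle leaves a connected path. The cycle is rotated to start at `v`;
between a point of `S` and a point outside it, some step of the remaining path changes sides. -/
theorem IsHamCycleGraph.exists_adj_of_cut {P : Finset ℂ} {G : SimpleGraph P}
    (hG : IsHamCycleGraph G) {S : Set P} {v : P} (hS : S.Nonempty) (hv : v ∉ S)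
    (hout : ∃ u, u ∉ S ∧ u ≠ v) : ∃ a ∈ S, ∃ b, b ∉ S ∧ b ≠ v ∧ G.Adj a b := by
  classical
  obtain ⟨a, w, hw, hE⟩ := hG
  have hmem : v ∈ w.support := hw.mem_support v
  set p := w.rotate v hmem with hp
  have hpH : p.IsHamiltonianCycle := by
    rw [hp]; exact (SimpleGraph.Walk.isHamiltonianCycle_rotate hmem).2 hw
  have hadj : ∀ i, i < p.length → G.Adj (p.getVert i) (p.getVert (i + 1)) := by
    intro i hi
    rw [← SimpleGraph.mem_edgeSet, hE]
    have : s(p.getVert i, p.getVert (i + 1)) ∈ p.edges := by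
      rw [← SimpleGraph.Walk.adj_toSubgraph_iff_mem_edges]
      exact SimpleGraph.Walk.toSubgraph_adj_getVert p hi
    exact (w.rotate_edges v hmem).mem_iff.1 this
  have hinj : ∀ i, 0 < i → i < p.length → p.getVert i ≠ v := by
    intro i h0 hi h
    have h1 := hpH.isCycle.getVert_injOn' (show (0 : ℕ) ∈ {i | i ≤ p.length - 1} by simp)
      (show i ∈ {i | i ≤ p.length - 1} by simp; omega) (by rw [h]; simp)
    omega
  have hidx : ∀ u, u ≠ v → ∃ i, 0 < i ∧ i < p.length ∧ p.getVert i = u := by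
    intro u hu
    obtain ⟨i, hi, hile⟩ := SimpleGraph.Walk.mem_support_iff_exists_getVert.1 (hpH.mem_support u)
    refine ⟨i, Nat.pos_of_ne_zero ?_, lt_of_le_of_ne hile ?_, hi⟩
    · rintro rfl; apply hu; rw [← hi]; simp
    · rintro rfl; apply hu; rw [← hi]; simp
  have key : ∀ (Q : P → Prop) (i j : ℕ), i ≤ j → Q (p.getVert i) → ¬ Q (p.getVert j) →
      ∃ l, i ≤ l ∧ l < j ∧ Q (p.getVert l) ∧ ¬ Q (p.getVert (l + 1)) := by
    intro Q i j hij hi hj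
    induction j, hij using Nat.le_induction with
    | base => exact absurd hi hj
    | succ j hij ih =>
      by_cases h : Q (p.getVert j)
      · exact ⟨j, hij, by omega, h, hj⟩
      · obtain ⟨l, h1, h2, h3⟩ := ih h
        exact ⟨l, h1, by omega, h3⟩
  obtain ⟨s, hs⟩ := hS
  obtain ⟨u, hu, huv⟩ := hout
  obtain ⟨i, hi0, hi, rfl⟩ := hidx s (fun h => hv (h ▸ hs))
  obtain ⟨j, hj0, hj, rfl⟩ := hidx u huv
  rcases le_total i j with hij | hij
  · obtain ⟨l, h1, h2, h3, h4⟩ := key (· ∈ S) i j hij hs hu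
    exact ⟨_, h3, _, h4, hinj _ (by omega) (by omega), hadj l (by omega)⟩
  · obtain ⟨l, h1, h2, h3, h4⟩ := key (· ∉ S) j i hij hu (not_not.2 hs)
    exact ⟨_, not_not.1 h4, _, h3, hinj _ (by omega) (by omega), (hadj l (by omega)).symm⟩

theorem IsOnePlane.eq_of_cross {P : Finset ℂ} {G : SimpleGraph P} (hG : IsOnePlane G)
    {a b x y x' y' : P} (hab : G.Adj a b) (h : G.Adj x y) (h' : G.Adj x' y')
    (hc : EdgesCross s(a, b) s(x, y)) (hc' : EdgesCross s(a, b) s(x', y')) :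
    s(x, y) = s(x', y') :=
  Set.encard_le_one_iff.1 (hG s(a, b) hab) _ _ ⟨h, hc⟩ ⟨h', hc'⟩

theorem IsHamCycleGraph.eq_or_eq {P : Finset ℂ} {G : SimpleGraph P} (hG : IsHamCycleGraph G)
    {v x y z : P} (hx : G.Adj v x) (hy : G.Adj v y) (hxy : x ≠ y) (hz : G.Adj v z) :
    z = x ∨ z = y := by
  obtain ⟨p, q, hpq, h⟩ := hG.exists_adj_iff v
  rw [h] at hx hy hz
  grind

theorem IsHamCycleGraph.exists_other {P : Finset ℂ} {G : SimpleGraph P} (hG : IsHamCycleGraph G)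
    (v x : P) : ∃ y, y ≠ x ∧ G.Adj v y := by
  obtain ⟨p, q, hpq, h⟩ := hG.exists_adj_iff v
  by_cases hp : p = x
  · exact ⟨q, fun h => hpq (hp.trans h.symm), (h q).2 (Or.inr rfl)⟩
  · exact ⟨p, hp, (h p).2 (Or.inl rfl)⟩

namespace IsWheelLabelling

variable {m : ℤ} {P : Finset ℂ} {c : P} {f : ℤ → P}

theorem inj (W : IsWheelLabelling m c f) {a b : ℤ} (h : f a = f b) (h1 : a < b + m)
    (h2 : b < a + m) : a = b := by
  obtain ⟨k, hk⟩ := (W.eq_iff a b).1 h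
  have hm := W.pos
  have : k < 1 := by nlinarith
  have : -1 < k := by nlinarith
  obtain rfl : k = 0 := by omega
  linarith

theorem add_period (W : IsWheelLabelling m c f) (a : ℤ) : f (a + m) = f a :=
  (W.eq_iff _ _).2 ⟨1, by ring⟩

theorem exists_rep (W : IsWheelLabelling m c f) (w : ℤ) {v : P} (hv : v ≠ c) :
    ∃ a, w ≤ a ∧ a < w + m ∧ v = f a := by
  obtain ⟨a, rfl⟩ := (W.eq_center_or v).resolve_left hv
  have h1 := Int.emod_lt_of_pos (a - w) W.pos
  have h2 := Int.emod_nonneg (a - w) W.pos.ne'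
  refine ⟨w + (a - w) % m, by omega, by omega, (W.eq_iff _ _).2 ?_⟩
  have := Int.dvd_self_sub_emod (x := a - w) (m := m)
  rwa [show a - w - (a - w) % m = a - (w + (a - w) % m) by ring] at this

theorem translate (W : IsWheelLabelling m c f) (d : ℤ) :
    IsWheelLabelling m c (fun k => f (k + d)) where
  pos := W.pos
  odd := W.odd
  eq_iff a b := by rw [W.eq_iff]; ring_nf
  ne_center a := W.ne_center _
  eq_center_or v := (W.eq_center_or v).imp_right
    fun ⟨a, ha⟩ => ⟨a - d, by rw [ha, sub_add_cancel]⟩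
  chord_cross a b x y h1 h2 h3 h4 :=
    W.chord_cross _ _ _ _ (by omega) (by omega) (by omega) (by omega)
  spoke_cross a b x h1 h2 h3 := W.spoke_cross _ _ _ (by omega) (by omega) (by omega)
  of_chord_cross w a b x y h1 h2 h3 h4 h5 h6 h := by
    have := W.of_chord_cross (w + d) _ _ _ _ (by omega) (by omega) (by omega) (by omega) (by omega)
      (by omega) h
    omega
  of_spoke_cross w a b x h1 h2 h3 h4 h5 h := by
    have := W.of_spoke_cross (w + d) _ _ _ (by omega) (by omega) (by omega) (by omega) (by omega) h
    omega
  not_spokes_cross a b := W.not_spokes_cross _ _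

theorem reflect (W : IsWheelLabelling m c f) : IsWheelLabelling m c (fun k => f (-k)) where
  pos := W.pos
  odd := W.odd
  eq_iff a b := by
    rw [W.eq_iff, ← dvd_neg]; ring_nf
  ne_center a := W.ne_center _
  eq_center_or v := (W.eq_center_or v).imp_right fun ⟨a, ha⟩ => ⟨-a, by rw [ha, neg_neg]⟩
  chord_cross a b x y h1 h2 h3 h4 := by
    have := W.chord_cross (-y) (-x) (-b) (-a) (by omega) (by omega) (by omega) (by omega)
    rw [Sym2.eq_swap, Sym2.eq_swap (a := f (-x))]
    exact this.symm
  spoke_cross a b x h1 h2 h3 := by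
    rw [Sym2.eq_swap]
    exact W.spoke_cross _ _ _ (by omega) (by omega) (by omega)
  of_chord_cross w a b x y h1 h2 h3 h4 h5 h6 h := by
    rw [Sym2.eq_swap, Sym2.eq_swap (a := f (-x))] at h
    have := W.of_chord_cross (-w - m + 1) _ _ _ _ (by omega) (by omega) (by omega) (by omega)
      (by omega) (by omega) h
    omega
  of_spoke_cross w a b x h1 h2 h3 h4 h5 h := by
    rw [Sym2.eq_swap] at h
    have := W.of_spoke_cross (-w - m + 1) _ _ _ (by omega) (by omega) (by omega) (by omega)
      (by omega) h
    omega
  not_spokes_cross a b := W.not_spokes_cross _ _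

end IsWheelLabelling

/-! ### Units, runs and minimal arcs -/

/-- The rim vertex `j` is owned by `G`: either both boundary edges at `j` belong to `G`, or one of
them does, together with the chord joining the two rim neighbours of `j`. -/
def OwnsRim {P : Finset ℂ} (G : SimpleGraph P) (f : ℤ → P) (j : ℤ) : Prop :=
  (G.Adj (f (j - 1)) (f j) ∧ G.Adj (f j) (f (j + 1))) ∨
  (G.Adj (f (j - 1)) (f (j + 1)) ∧ (G.Adj (f (j - 1)) (f j) ∨ G.Adj (f j) (f (j + 1))))

/-- Even units are owned rim vertices, odd units are boundary edges. -/
def IsRimUnit {P : Finset ℂ} (G : SimpleGraph P) (f : ℤ → P) (u : ℤ) : Prop :=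
  (∃ j, u = 2 * j ∧ OwnsRim G f j) ∨ (∃ j, u = 2 * j + 1 ∧ G.Adj (f j) (f (j + 1)))

/-- Six units within one turn around the rim. -/
def HasSixUnits {P : Finset ℂ} (m : ℤ) (G : SimpleGraph P) (f : ℤ → P) : Prop :=
  ∃ u₁ u₂ u₃ u₄ u₅ u₆, u₁ < u₂ ∧ u₂ < u₃ ∧ u₃ < u₄ ∧ u₄ < u₅ ∧ u₅ < u₆ ∧ u₆ < u₁ + 2 * m ∧
    IsRimUnit G f u₁ ∧ IsRimUnit G f u₂ ∧ IsRimUnit G f u₃ ∧ IsRimUnit G f u₄ ∧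
    IsRimUnit G f u₅ ∧ IsRimUnit G f u₆

/-- An edge of `G` joining the ends of the arc `[a, b]`, inside which no other chord is drawn. -/
structure IsMinimalArc {P : Finset ℂ} (m : ℤ) (G : SimpleGraph P) (f : ℤ → P) (a b : ℤ) :
    Prop where
  lower : a + 2 ≤ b
  upper : b + 2 ≤ a + m
  adj : G.Adj (f a) (f b)
  minimal : ∀ x y, a ≤ x → x + 2 ≤ y → y ≤ b → G.Adj (f x) (f y) → x = a ∧ y = b

/-- Three consecutive units over the arc `[a, b]`. The last two conditions control the case in
which one of them is an end of the arc. -/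
def HasUnitRun {P : Finset ℂ} (G : SimpleGraph P) (f : ℤ → P) (a b : ℤ) : Prop :=
  ∃ u, 2 * a < u ∧ u < 2 * b ∧ IsRimUnit G f (u - 1) ∧ IsRimUnit G f u ∧ IsRimUnit G f (u + 1) ∧
    (u - 1 = 2 * a → G.Adj (f a) (f (a + 1)) ∧ G.Adj (f a) (f (a + 2))) ∧
    (u + 1 = 2 * b → G.Adj (f b) (f (b - 1)) ∧ G.Adj (f b) (f (b - 2)))

/-- A triangle-like end of the cycle running into the center. -/
def IsSpokeEnd {P : Finset ℂ} (G : SimpleGraph P) (c : P) (f : ℤ → P) (a b : ℤ) : Prop :=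
  b = a + 2 ∧ G.Adj (f a) (f b) ∧ G.Adj c (f (a + 1)) ∧
    (G.Adj (f a) (f (a + 1)) ∨ G.Adj (f (a + 1)) (f b))

section Units

variable {P : Finset ℂ} {G : SimpleGraph P} {f : ℤ → P}

theorem isRimUnit_boundary {j : ℤ} (h : G.Adj (f j) (f (j + 1))) : IsRimUnit G f (2 * j + 1) :=
  Or.inr ⟨j, rfl, h⟩

theorem isRimUnit_owned {j : ℤ} (h : OwnsRim G f j) : IsRimUnit G f (2 * j) :=
  Or.inl ⟨j, rfl, h⟩

theorem IsRimUnit.of_reflect {u : ℤ} (h : IsRimUnit G (fun k => f (-k)) u) :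
    IsRimUnit G f (-u) := by
  rcases h with ⟨j, rfl, h⟩ | ⟨j, rfl, h⟩
  · refine Or.inl ⟨-j, by ring, ?_⟩
    unfold OwnsRim at h ⊢
    simp only [show -(j - 1) = -j + 1 by ring, show -(j + 1) = -j - 1 by ring] at h
    rcases h with ⟨h1, h2⟩ | ⟨h1, h2⟩
    · exact Or.inl ⟨h2.symm, h1.symm⟩
    · exact Or.inr ⟨h1.symm, h2.symm.imp (fun h => h.symm) (fun h => h.symm)⟩
  · refine Or.inr ⟨-j - 1, by ring, ?_⟩
    rw [show -j - 1 + 1 = -j by ring, show -j - 1 = -(j + 1) by ring]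
    exact h.symm

theorem IsRimUnit.of_translate {u d : ℤ} (h : IsRimUnit G (fun k => f (k + d)) u) :
    IsRimUnit G f (u + 2 * d) := by
  rcases h with ⟨j, rfl, h⟩ | ⟨j, rfl, h⟩
  · refine Or.inl ⟨j + d, by ring, ?_⟩
    unfold OwnsRim at h ⊢
    simpa only [show j - 1 + d = j + d - 1 by ring, show j + 1 + d = j + d + 1 by ring] using h
  · refine Or.inr ⟨j + d, by ring, ?_⟩
    simpa only [show j + 1 + d = j + d + 1 by ring] using h

theorem HasSixUnits.of_reflect {m : ℤ} (h : HasSixUnits m G (fun k => f (-k))) :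
    HasSixUnits m G f := by
  obtain ⟨u₁, u₂, u₃, u₄, u₅, u₆, h1, h2, h3, h4, h5, h6, t1, t2, t3, t4, t5, t6⟩ := h
  exact ⟨-u₆, -u₅, -u₄, -u₃, -u₂, -u₁, by omega, by omega, by omega, by omega, by omega, by omega,
    t6.of_reflect, t5.of_reflect, t4.of_reflect, t3.of_reflect, t2.of_reflect, t1.of_reflect⟩

theorem HasSixUnits.of_translate {m d : ℤ} (h : HasSixUnits m G (fun k => f (k + d))) :
    HasSixUnits m G f := by
  obtain ⟨u₁, u₂, u₃, u₄, u₅, u₆, h1, h2, h3, h4, h5, h6, t1, t2, t3, t4, t5, t6⟩ := h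
  exact ⟨_, _, _, _, _, _, by omega, by omega, by omega, by omega, by omega, by omega,
    t1.of_translate, t2.of_translate, t3.of_translate, t4.of_translate, t5.of_translate,
    t6.of_translate⟩

theorem HasUnitRun.of_reflect {a b : ℤ} (h : HasUnitRun G (fun k => f (-k)) (-b) (-a)) :
    HasUnitRun G f a b := by
  obtain ⟨u, h1, h2, t1, t2, t3, h3, h4⟩ := h
  refine ⟨-u, by omega, by omega, ?_, t2.of_reflect, ?_, ?_, ?_⟩
  · rw [show -u - 1 = -(u + 1) by ring]; exact t3.of_reflect
  · rw [show -u + 1 = -(u - 1) by ring]; exact t1.of_reflect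
  · intro h
    have := h4 (by omega)
    simpa only [show -(-a - 1) = a + 1 by ring, show -(-a - 2) = a + 2 by ring, neg_neg] using this
  · intro h
    have := h3 (by omega)
    simpa only [show -(-b + 1) = b - 1 by ring, show -(-b + 2) = b - 2 by ring, neg_neg] using this

theorem IsMinimalArc.reflect {m a b : ℤ} (h : IsMinimalArc m G f a b) :
    IsMinimalArc m G (fun k => f (-k)) (-b) (-a) where
  lower := by have := h.lower; omega
  upper := by have := h.upper; omega
  adj := by simpa using h.adj.symm
  minimal x y h1 h2 h3 h4 := by
    have := h.minimal (-y) (-x) (by omega) (by omega) (by omega) h4.symm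
    omega

theorem IsSpokeEnd.of_reflect {c : P} {a b : ℤ}
    (h : IsSpokeEnd G c (fun k => f (-k)) (-b) (-a)) : IsSpokeEnd G c f a b := by
  obtain ⟨h1, h2, h3, h4⟩ := h
  have hb : b = a + 2 := by omega
  subst hb
  simp only [show -(-(a + 2) + 1) = a + 1 by ring, neg_neg] at h2 h3 h4
  exact ⟨rfl, h2.symm, h3, h4.symm.imp (fun h => h.symm) (fun h => h.symm)⟩

theorem exists_minimalArc {m : ℤ} {a b : ℤ} (h1 : a + 2 ≤ b) (h2 : b + 2 ≤ a + m)
    (h : G.Adj (f a) (f b)) : ∃ a' b', a ≤ a' ∧ b' ≤ b ∧ IsMinimalArc m G f a' b' := by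
  obtain ⟨n, hn⟩ : ∃ n : ℕ, b - a ≤ n := ⟨(b - a).toNat, by omega⟩
  induction n generalizing a b with
  | zero => omega
  | succ n ih =>
    by_cases hex : ∃ x y, a ≤ x ∧ x + 2 ≤ y ∧ y ≤ b ∧ G.Adj (f x) (f y) ∧ ¬ (x = a ∧ y = b)
    · obtain ⟨x, y, h3, h4, h5, h6, h7⟩ := hex
      obtain ⟨a', b', h8, h9, h10⟩ := ih h4 (by omega) h6 (by omega)
      exact ⟨a', b', by omega, by omega, h10⟩
    · push Not at hex
      exact ⟨a, b, le_rfl, le_rfl, h1, h2, h,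
        fun x y hx hxy hy hadj => hex x y hx hxy hy hadj⟩

end Units

/-! ### Constraints on edges leaving an arc -/

section Cycle

variable {m : ℤ} {P : Finset ℂ} {c : P} {f : ℤ → P} {G : SimpleGraph P}

namespace IsWheelLabelling

/-- An edge from inside the arc to a rim point outside it always crosses the closing chord. A spoke
does so only if the center lies beyond the chord, which is the last hypothesis. -/
theorem cross_of_leaving (W : IsWheelLabelling m c f) {a b j : ℤ} {z : P}
    (h1 : a < j) (h2 : j < b) (hz : ∀ k, a ≤ k → k ≤ b → z ≠ f k) (hc : z = c → 2 * (b - a) < m) :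
    EdgesCross s(f a, f b) s(f j, z) := by
  by_cases h : z = c
  · rw [h, Sym2.eq_swap (a := f j)]
    exact W.spoke_cross a b j h1 h2 (hc h)
  · obtain ⟨k, h3, h4, rfl⟩ := W.exists_rep a h
    have : b < k := by
      by_contra hk
      exact hz k h3 (by omega) rfl
    exact W.chord_cross a b j k h1 h2 this h4

/-- At most one edge of a 1-plane graph leaves an arc that is closed off by an edge. -/
theorem leaving_unique (W : IsWheelLabelling m c f) (hG : IsOnePlane G) {a b j j' : ℤ} {z z' : P}
    (hb : b < a + m) (hab : G.Adj (f a) (f b)) (h1 : a < j) (h2 : j < b) (hjz : G.Adj (f j) z)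
    (hz : ∀ k, a ≤ k → k ≤ b → z ≠ f k) (hc : z = c → 2 * (b - a) < m)
    (h1' : a < j') (h2' : j' < b) (hjz' : G.Adj (f j') z')
    (hz' : ∀ k, a ≤ k → k ≤ b → z' ≠ f k) (hc' : z' = c → 2 * (b - a) < m) :
    j = j' ∧ z = z' := by
  have h := hG.eq_of_cross hab hjz hjz' (W.cross_of_leaving h1 h2 hz hc)
    (W.cross_of_leaving h1' h2' hz' hc')
  rcases Sym2.eq_iff.1 h with ⟨h3, h4⟩ | ⟨h3, -⟩
  · exact ⟨W.inj h3 (by omega) (by omega), h4⟩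
  · exact absurd h3.symm (hz' j h1.le h2.le)

/-- A spoke crosses at most one chord. -/
theorem spoke_crosses_unique (W : IsWheelLabelling m c f) (hG : IsOnePlane G) {a b a' b' k : ℤ}
    (hk : G.Adj c (f k)) (hab : G.Adj (f a) (f b)) (hab' : G.Adj (f a') (f b'))
    (h1 : a < k) (h2 : k < b) (h3 : 2 * (b - a) < m)
    (h1' : a' < k) (h2' : k < b') (h3' : 2 * (b' - a') < m) : a = a' ∧ b = b' := by
  have h := hG.eq_of_cross hk hab hab' (W.spoke_cross a b k h1 h2 h3).symm
    (W.spoke_cross a' b' k h1' h2' h3').symm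
  rcases Sym2.eq_iff.1 h with ⟨h4, h5⟩ | ⟨h4, -⟩
  · exact ⟨W.inj h4 (by omega) (by omega), W.inj h5 (by omega) (by omega)⟩
  · have := W.inj h4 (by omega) (by omega)
    omega

theorem false_of_three_spokes (W : IsWheelLabelling m c f) (hG : IsHamCycleGraph G) {x y z : ℤ}
    (hx : G.Adj c (f x)) (hy : G.Adj c (f y)) (hz : G.Adj c (f z)) (h1 : x < y) (h2 : y < z)
    (h3 : z < x + m) : False := by
  have hxy : f x ≠ f y := fun h => by
    have := W.inj h (by omega) (by omega); omega
  rcases hG.eq_or_eq hx hy hxy hz with h | h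
  · have := W.inj h (by omega) (by omega); omega
  · have := W.inj h (by omega) (by omega); omega

/-- At a rim vertex with two given rim neighbours there is no third neighbour. -/
theorem eq_or_eq (W : IsWheelLabelling m c f) (hG : IsHamCycleGraph G) {v : P} {x y : ℤ} {z : P}
    (hx : G.Adj v (f x)) (hy : G.Adj v (f y)) (h1 : x < y) (h2 : y < x + m) (hz : G.Adj v z) :
    z = f x ∨ z = f y :=
  hG.eq_or_eq hx hy (fun h => by have := W.inj h (by omega) (by omega); omega) hz

/-- An edge leaves every proper arc of the rim while avoiding a given vertex. -/
theorem exists_leaving (W : IsWheelLabelling m c f) (hG : IsHamCycleGraph G) {a b : ℤ} {v : P}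
    (h1 : a ≤ b) (h2 : b + 1 < a + m) (hv : ∀ k, a ≤ k → k ≤ b → v ≠ f k) :
    ∃ j z, a ≤ j ∧ j ≤ b ∧ G.Adj (f j) z ∧ z ≠ v ∧ ∀ k, a ≤ k → k ≤ b → z ≠ f k := by
  have key := hG.exists_adj_of_cut (S := {w | ∃ k, a ≤ k ∧ k ≤ b ∧ w = f k}) (v := v)
    ⟨f a, a, le_rfl, h1, rfl⟩ (fun ⟨k, h3, h4, h5⟩ => hv k h3 h4 h5) ?_
  · obtain ⟨-, ⟨j, h3, h4, rfl⟩, z, h5, h6, h7⟩ := key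
    exact ⟨j, z, h3, h4, h7, h6, fun k hk hk' h => h5 ⟨k, hk, hk', h⟩⟩
  · by_cases hvc : v = c
    · refine ⟨f (b + 1), ?_, ?_⟩
      · rintro ⟨k, h3, h4, h5⟩
        have := W.inj h5 (by omega) (by omega); omega
      · rw [hvc]; exact W.ne_center _
    · refine ⟨c, ?_, fun h => hvc h.symm⟩
      rintro ⟨k, h3, h4, h5⟩
      exact W.ne_center k h5.symm

end IsWheelLabelling

end Cycle

/-! ### What a cycle does inside a minimal arc -/

section MinimalArc

variable {m : ℤ} {P : Finset ℂ} {c : P} {f : ℤ → P} {G : SimpleGraph P} {a b : ℤ}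

/-- Inside a minimal arc all edges are boundary edges. -/
theorem IsMinimalArc.adj_cases (h : IsMinimalArc m G f a b) {j : ℤ} {z : P} (h1 : a < j)
    (h2 : j < b) (hz : G.Adj (f j) z) :
    z = f (j - 1) ∨ z = f (j + 1) ∨ ∀ k, a ≤ k → k ≤ b → z ≠ f k := by
  by_contra! hcon
  obtain ⟨h3, h4, k, h5, h6, rfl⟩ := hcon
  rcases lt_trichotomy k j with h7 | rfl | h7
  · have : k ≠ j - 1 := fun h => h3 (h ▸ rfl)
    have := h.minimal k j h5 (by omega) h2.le hz.symm
    omega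
  · exact hz.ne rfl
  · have : k ≠ j + 1 := fun h => h4 (h ▸ rfl)
    have := h.minimal j k h1.le (by omega) h6 hz
    omega

namespace IsWheelLabelling

/-- A cut avoiding `f b` gives an edge leaving the arc. If it starts at `f a`, then this edge and
the chord are the only two at `f a`, so a second cut, of the interior alone, must produce an edge
that also avoids `f a`. -/
theorem exists_leaving_of_minimalArc (W : IsWheelLabelling m c f) (hG : IsHamCycleGraph G)
    (h : IsMinimalArc m G f a b) :
    ∃ j z, a < j ∧ j < b ∧ G.Adj (f j) z ∧ ∀ k, a ≤ k → k ≤ b → z ≠ f k := by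
  have hl := h.lower
  have hu := h.upper
  by_contra! hcon
  have hne : ∀ k, a ≤ k → k ≤ b - 1 → f b ≠ f k := fun k h1 h2 h3 => by
    have := W.inj h3 (by omega) (by omega); omega
  obtain ⟨j, z, h1, h2, h3, h4, h5⟩ := W.exists_leaving hG (a := a) (b := b - 1) (v := f b)
    (by omega) (by omega) hne
  have hz : ∀ k, a ≤ k → k ≤ b → z ≠ f k := by
    intro k hk hk'
    rcases eq_or_ne k b with rfl | hkb
    · exact h4
    · exact h5 k hk (by omega)
  obtain rfl : j = a := by
    by_contra hja
    obtain ⟨k, hk, hk', hk''⟩ := hcon j z (by omega) (by omega) h3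
    exact hz k hk hk' hk''
  obtain ⟨i, y, h6, h7, h8, h9, h10⟩ := W.exists_leaving hG (a := j + 1) (b := b - 1) (v := f b)
    (by omega) (by omega) (fun k hk hk' => hne k (by omega) hk')
  obtain ⟨k, hk, hk', rfl⟩ := hcon i y (by omega) (by omega) h8
  have hkj : k = j := by
    by_contra hkj
    by_cases hkb : k = b
    · exact h9 (hkb ▸ rfl)
    · exact h10 k (by omega) (by omega) rfl
  subst hkj
  rcases hG.eq_or_eq h3 h.adj h4 h8.symm with h11 | h11
  · exact hz i (by omega) (by omega) h11.symm
  · exact hne i (by omega) h7 h11.symm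

/-- A minimal arc off the center from which an edge leaves at the lower end. -/
theorem run_or_spokeEnd_of_path (W : IsWheelLabelling m c f) (hH : IsHamCycleGraph G)
    (hG : IsOnePlane G) (h : IsMinimalArc m G f a b) (hfree : 2 * (b - a) < m) {j : ℤ} {z : P}
    (h1 : a < j) (h2 : j < b) (hjz : G.Adj (f j) z) (hz : ∀ k, a ≤ k → k ≤ b → z ≠ f k)
    (hnext : G.Adj (f j) (f (j + 1))) (hprev : ¬ G.Adj (f j) (f (j - 1))) :
    HasUnitRun G f a b ∨ IsSpokeEnd G c f a b := by
  have hl := h.lower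
  have hu := h.upper
  have hinner : ∀ i y, a < i → i < b → i ≠ j → G.Adj (f i) y → y = f (i - 1) ∨ y = f (i + 1) := by
    intro i y hi hi' hij hy
    rcases h.adj_cases hi hi' hy with h3 | h3 | h3
    · exact Or.inl h3
    · exact Or.inr h3
    · exact absurd (W.leaving_unique hG (by omega) h.adj hi hi' hy h3 (fun _ => hfree)
        h1 h2 hjz hz (fun _ => hfree)).1 hij
  -- Otherwise the points strictly between `a` and `j` could be left only through `f a`, since their
  -- one other exit, to `f j`, is excluded by `hprev`.
  have hja : j = a + 1 := by
    by_contra hja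
    obtain ⟨i, y, h3, h4, h5, h6, h7⟩ := W.exists_leaving hH (a := a + 1) (b := j - 1) (v := f a)
      (by omega) (by omega) (fun k hk hk' h8 => by
        have := W.inj h8 (by omega) (by omega); omega)
    rcases hinner i y (by omega) (by omega) (by omega) h5 with rfl | rfl
    · by_cases hi : i = a + 1
      · exact h6 (by rw [hi, add_sub_cancel_right])
      · exact h7 (i - 1) (by omega) (by omega) rfl
    · by_cases hi : i = j - 1
      · apply hprev
        rw [hi, sub_add_cancel] at h5
        exact h5.symm
      · exact h7 (i + 1) (by omega) (by omega) rfl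
  have hboth : ∀ i, j < i → i < b → G.Adj (f (i - 1)) (f i) ∧ G.Adj (f i) (f (i + 1)) := by
    intro i hi hi'
    obtain ⟨y, hy, hiy⟩ := hH.exists_other (f i) (f (i + 1))
    obtain ⟨y', hy', hiy'⟩ := hH.exists_other (f i) (f (i - 1))
    have e := (hinner i y (by omega) hi' (by omega) hiy).resolve_right hy
    have e' := (hinner i y' (by omega) hi' (by omega) hiy').resolve_left hy'
    exact ⟨(e ▸ hiy).symm, e' ▸ hiy'⟩
  subst hja
  rw [show a + 1 + 1 = a + 2 by ring] at hnext
  rcases eq_or_lt_of_le hl with hb | hb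
  · subst hb
    by_cases hzc : z = c
    · subst hzc
      exact Or.inr ⟨rfl, h.adj, hjz.symm, Or.inr hnext⟩
    obtain ⟨w, h3, h4, rfl⟩ := W.exists_rep a hzc
    have hw : a + 2 < w := by
      by_contra hw
      exact hz w h3 (by omega) rfl
    rcases eq_or_lt_of_le (show a + 3 ≤ w by omega) with rfl | hw'
    · left
      refine ⟨2 * (a + 1) + 1, by omega, by omega, ?_, ?_, ?_, fun h => by omega, fun _ => ?_⟩
      · rw [add_sub_cancel_right]
        refine isRimUnit_owned (Or.inr ?_)
        rw [add_sub_cancel_right, show a + 1 + 1 = a + 2 by ring]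
        exact ⟨h.adj, Or.inr hnext⟩
      · refine isRimUnit_boundary ?_
        rw [show a + 1 + 1 = a + 2 by ring]; exact hnext
      · rw [show 2 * (a + 1) + 1 + 1 = 2 * (a + 2) by ring]
        refine isRimUnit_owned (Or.inr ?_)
        rw [show a + 2 - 1 = a + 1 by ring, show a + 2 + 1 = a + 3 by ring]
        exact ⟨hjz, Or.inl hnext⟩
      · rw [show a + 2 - 1 = a + 1 by ring, show a + 2 - 2 = a by ring]
        exact ⟨hnext.symm, h.adj.symm⟩
    -- Now `f w` lies beyond `f (a + 3)`, and the chord from `f (a + 1)` to `f w` is already crossed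
    -- by the one from `f a` to `f (a + 2)`. On the side of it away from the center, a cut avoiding
    -- `f w` forces a second crossing.
    exfalso
    have hdb : ∀ y, G.Adj (f (a + 2)) y → y = f a ∨ y = f (a + 1) := fun y hy =>
      W.eq_or_eq hH h.adj.symm hnext.symm (by omega) (by omega) hy
    have hdj : ∀ y, G.Adj (f (a + 1)) y → y = f (a + 2) ∨ y = f w := fun y hy =>
      W.eq_or_eq hH hnext hjz hw (by omega) hy
    have hodd : 2 * (w - (a + 1)) < m ∨ m < 2 * (w - (a + 1)) := by
      rcases W.odd with ⟨k, hk⟩; omega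
    rcases hodd with hside | hside
    · obtain ⟨i, y, h5, h6, h7, h8, h9⟩ := W.exists_leaving hH (a := a + 3) (b := w - 1) (v := f w)
        (by omega) (by omega) (fun k hk hk' h8 => by
          have := W.inj h8 (by omega) (by omega); omega)
      have hy : ∀ k, a + 1 ≤ k → k ≤ w → y ≠ f k := by
        rintro k hk hk' rfl
        by_cases e1 : k = a + 1
        · subst e1
          rcases hdj _ h7.symm with e | e
          · have := W.inj e (by omega) (by omega); omega
          · have := W.inj e (by omega) (by omega); omega
        by_cases e2 : k = a + 2
        · subst e2
          rcases hdb _ h7.symm with e | e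
          · have := W.inj e (by omega) (by omega); omega
          · have := W.inj e (by omega) (by omega); omega
        by_cases e3 : k = w
        · exact h8 (e3 ▸ rfl)
        · exact h9 k (by omega) (by omega) rfl
      have := (W.leaving_unique hG (by omega) hjz (show a + 1 < a + 2 by omega) hw h.adj.symm
        (fun k hk hk' e => by have := W.inj e (by omega) (by omega); omega) (fun _ => hside)
        (show a + 1 < i by omega) (by omega) h7 hy (fun _ => hside)).1
      omega
    · obtain ⟨i, y, h5, h6, h7, h8, h9⟩ := W.exists_leaving hH (a := w + 1) (b := a + m + 2)
        (v := f w) (by omega) (by omega) (fun k hk hk' h8 => by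
          have := W.inj h8 (by omega) (by omega); omega)
      have hper : ∀ k, f (a + m + k) = f (a + k) := fun k => by
        rw [show a + m + k = a + k + m by ring, W.add_period]
      have hi : i ≤ a + m := by
        by_contra hi
        have : i = a + m + 1 ∨ i = a + m + 2 := by omega
        rcases this with rfl | rfl
        · rw [hper] at h7
          rcases hdj _ h7 with rfl | rfl
          · exact h9 (a + m + 2) (by omega) (by omega) (hper 2).symm
          · exact h8 rfl
        · rw [hper] at h7
          rcases hdb _ h7 with rfl | rfl
          · exact h9 (a + m) (by omega) (by omega) (W.add_period a).symm
          · exact h9 (a + m + 1) (by omega) (by omega) (hper 1).symm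
      have hwm : G.Adj (f w) (f (a + m + 1)) := by rw [hper]; exact hjz.symm
      have hy : ∀ k, w ≤ k → k ≤ a + m + 1 → y ≠ f k := by
        rintro k hk hk' rfl
        by_cases e3 : k = w
        · exact h8 (e3 ▸ rfl)
        · exact h9 k (by omega) (by omega) rfl
      have hadj' : G.Adj (f (a + m)) (f (a + m + 2)) := by
        rw [hper, W.add_period]; exact h.adj
      have := (W.leaving_unique hG (by omega) hwm (show w < a + m by omega) (by omega) hadj'
        (fun k hk hk' e => by have := W.inj e (by omega) (by omega); omega) (fun _ => by omega)
        (show w < i by omega) (by omega) h7 hy (fun _ => by omega)).2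
      exact h9 (a + m + 2) (by omega) (by omega) this.symm
  · left
    have h3 := (hboth (b - 1) (by omega) (by omega))
    rw [show b - 1 - 1 = b - 2 by ring, sub_add_cancel] at h3
    refine ⟨2 * (b - 1), by omega, by omega, ?_, ?_, ?_, fun h => by omega, fun h => by omega⟩
    · rw [show 2 * (b - 1) - 1 = 2 * (b - 2) + 1 by ring]
      refine isRimUnit_boundary ?_
      rw [show b - 2 + 1 = b - 1 by ring]; exact h3.1
    · refine isRimUnit_owned (Or.inl ?_)
      rw [show b - 1 - 1 = b - 2 by ring, sub_add_cancel]; exact h3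
    · refine isRimUnit_boundary ?_
      rw [sub_add_cancel]; exact h3.2

/-- The center is beyond the chord, so all edges leaving the interior cross it and there is exactly
one. Its inner end continues along the boundary, upward or downward; reflection makes this upward.
-/
theorem run_or_spokeEnd_of_free (W : IsWheelLabelling m c f) (hH : IsHamCycleGraph G)
    (hG : IsOnePlane G) (h : IsMinimalArc m G f a b) (hfree : 2 * (b - a) < m) :
    HasUnitRun G f a b ∨ IsSpokeEnd G c f a b := by
  have hu := h.upper
  obtain ⟨j, z, h1, h2, h3, h4⟩ := W.exists_leaving_of_minimalArc hH h
  have hne : f (j - 1) ≠ f (j + 1) := fun e => by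
    have := W.inj e (by omega) (by omega); omega
  obtain ⟨y, hy, hjy⟩ := hH.exists_other (f j) z
  have hout : ¬ ∀ k, a ≤ k → k ≤ b → y ≠ f k := fun h5 =>
    hy (W.leaving_unique hG (by omega) h.adj h1 h2 hjy h5 (fun _ => hfree) h1 h2 h3 h4 (fun _ => hfree)).2
  have hnot : ¬ (G.Adj (f j) (f (j - 1)) ∧ G.Adj (f j) (f (j + 1))) := by
    rintro ⟨h5, h6⟩
    rcases hH.eq_or_eq h5 h6 hne h3 with h7 | h7
    · exact h4 _ (by omega) (by omega) h7
    · exact h4 _ (by omega) (by omega) h7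
  rcases h.adj_cases h1 h2 hjy with rfl | rfl | h5
  · have hr := W.reflect.run_or_spokeEnd_of_path hH hG h.reflect (by omega) (j := -j) (z := z)
      (by omega) (by omega) (by rwa [neg_neg])
      (fun k hk hk' => h4 (-k) (by omega) (by omega))
      (by rwa [neg_neg, show -(-j + 1) = j - 1 by ring])
      (by rw [neg_neg, show -(-j - 1) = j + 1 by ring]; exact fun h => hnot ⟨hjy, h⟩)
    exact hr.imp HasUnitRun.of_reflect IsSpokeEnd.of_reflect
  · exact W.run_or_spokeEnd_of_path hH hG h hfree h1 h2 h3 h4 hjy fun h => hnot ⟨h, hjy⟩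
  · exact absurd h5 hout

theorem run_of_owned {j : ℤ} (h1 : a < j) (h2 : j < b) (h3 : G.Adj (f (j - 1)) (f j))
    (h4 : G.Adj (f j) (f (j + 1))) : HasUnitRun G f a b := by
  refine ⟨2 * j, by omega, by omega, ?_, isRimUnit_owned (Or.inl ⟨h3, h4⟩),
    isRimUnit_boundary h4, fun h => by omega, fun h => by omega⟩
  rw [show 2 * j - 1 = 2 * (j - 1) + 1 by ring]
  refine isRimUnit_boundary ?_
  rwa [sub_add_cancel]

/-- The arc exceeds half the rim, so `9 ≤ m` gives at least four interior points. At most two carry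
spokes and at most one sends an edge across the chord to the rim; a remaining point has both of its
boundary edges, which is a run. -/
theorem run_of_center (W : IsWheelLabelling m c f) (hH : IsHamCycleGraph G)
    (hG : IsOnePlane G) (hm : 9 ≤ m) (h : IsMinimalArc m G f a b) (hside : m < 2 * (b - a)) :
    HasUnitRun G f a b := by
  have hu := h.upper
  by_contra hno
  have special : ∀ j, a < j → j < b → G.Adj c (f j) ∨
      ∃ z, z ≠ c ∧ G.Adj (f j) z ∧ ∀ k, a ≤ k → k ≤ b → z ≠ f k := by
    intro j h1 h2
    by_contra! hcon
    obtain ⟨h3, h4⟩ := hcon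
    have hin : ∀ y, G.Adj (f j) y → y = f (j - 1) ∨ y = f (j + 1) := by
      intro y hy
      rcases h.adj_cases h1 h2 hy with h5 | h5 | h5
      · exact Or.inl h5
      · exact Or.inr h5
      · obtain ⟨k, hk, hk', e⟩ := h4 y (fun e => h3 (e ▸ hy.symm)) hy
        exact absurd e (h5 k hk hk')
    obtain ⟨y, hy, hjy⟩ := hH.exists_other (f j) (f (j + 1))
    obtain ⟨y', hy', hjy'⟩ := hH.exists_other (f j) (f (j - 1))
    have e := (hin y hjy).resolve_right hy
    have e' := (hin y' hjy').resolve_left hy'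
    exact hno (run_of_owned h1 h2 (e ▸ hjy).symm (e' ▸ hjy'))
  have hspokes : ∀ x y z, a < x → x < y → y < z → z < b → G.Adj c (f x) → G.Adj c (f y) →
      G.Adj c (f z) → False := fun x y z h1 h2 h3 h4 hx hy hz =>
    W.false_of_three_spokes hH hx hy hz h2 h3 (by omega)
  have hleave : ∀ x y, a < x → x < y → y < b →
      (∃ z, z ≠ c ∧ G.Adj (f x) z ∧ ∀ k, a ≤ k → k ≤ b → z ≠ f k) →
      (∃ z, z ≠ c ∧ G.Adj (f y) z ∧ ∀ k, a ≤ k → k ≤ b → z ≠ f k) → False := by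
    rintro x y h1 h2 h3 ⟨z, hz, hxz, ho⟩ ⟨z', hz', hxz', ho'⟩
    have := (W.leaving_unique hG (by omega) h.adj h1 (by omega) hxz ho (fun e => absurd e hz)
      (by omega) h3 hxz' ho' (fun e => absurd e hz')).1
    omega
  rcases special (a + 1) (by omega) (by omega) with s1 | s1 <;>
  rcases special (a + 2) (by omega) (by omega) with s2 | s2 <;>
  rcases special (a + 3) (by omega) (by omega) with s3 | s3 <;>
  rcases special (a + 4) (by omega) (by omega) with s4 | s4 <;>
  first
    | exact hspokes _ _ _ (by omega) (by omega) (by omega) (by omega) s1 s2 s3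
    | exact hspokes _ _ _ (by omega) (by omega) (by omega) (by omega) s1 s2 s4
    | exact hspokes _ _ _ (by omega) (by omega) (by omega) (by omega) s1 s3 s4
    | exact hspokes _ _ _ (by omega) (by omega) (by omega) (by omega) s2 s3 s4
    | exact hleave _ _ (by omega) (by omega) (by omega) s1 s2
    | exact hleave _ _ (by omega) (by omega) (by omega) s1 s3
    | exact hleave _ _ (by omega) (by omega) (by omega) s1 s4
    | exact hleave _ _ (by omega) (by omega) (by omega) s2 s3
    | exact hleave _ _ (by omega) (by omega) (by omega) s2 s4
    | exact hleave _ _ (by omega) (by omega) (by omega) s3 s4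

theorem run_or_spokeEnd (W : IsWheelLabelling m c f) (hH : IsHamCycleGraph G)
    (hG : IsOnePlane G) (hm : 9 ≤ m) (h : IsMinimalArc m G f a b) :
    HasUnitRun G f a b ∨ IsSpokeEnd G c f a b := by
  have : 2 * (b - a) < m ∨ m < 2 * (b - a) := by
    rcases W.odd with ⟨k, hk⟩; omega
  rcases this with h1 | h1
  · exact W.run_or_spokeEnd_of_free hH hG h h1
  · exact Or.inl (W.run_of_center hH hG hm h h1)

end IsWheelLabelling

end MinimalArc

/-! ### Six units in every 1-plane Hamiltonian cycle -/

section SixUnits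

variable {m : ℤ} {P : Finset ℂ} {c : P} {f : ℤ → P} {G : SimpleGraph P}

namespace IsWheelLabelling

theorem boundary_of_nbrs (hH : IsHamCycleGraph G) {j : ℤ}
    (h : ∀ y, G.Adj (f j) y → y = f (j - 1) ∨ y = f (j + 1)) :
    G.Adj (f (j - 1)) (f j) ∧ G.Adj (f j) (f (j + 1)) := by
  obtain ⟨y, hy, hjy⟩ := hH.exists_other (f j) (f (j + 1))
  obtain ⟨y', hy', hjy'⟩ := hH.exists_other (f j) (f (j - 1))
  have e := (h y hjy).resolve_right hy
  have e' := (h y' hjy').resolve_left hy'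
  exact ⟨(e ▸ hjy).symm, e' ▸ hjy'⟩

/-- Of the pairwise non-adjacent points `f 0`, `f 2`, `f 4`, `f 6`, at least two carry no spoke.
Each of these has both boundary edges and so contributes three units. -/
theorem sixUnits_of_no_chord (W : IsWheelLabelling m c f) (hH : IsHamCycleGraph G) (hm : 9 ≤ m)
    (h : ∀ a b, a + 2 ≤ b → b + 2 ≤ a + m → ¬ G.Adj (f a) (f b)) : HasSixUnits m G f := by
  have hb : ∀ j, ¬ G.Adj c (f j) → G.Adj (f (j - 1)) (f j) ∧ G.Adj (f j) (f (j + 1)) := by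
    intro j hj
    refine boundary_of_nbrs hH fun y hy => ?_
    have hyc : y ≠ c := fun e => hj (e ▸ hy.symm)
    obtain ⟨k, h1, h2, rfl⟩ := W.exists_rep (j - 1) hyc
    by_cases e1 : k = j - 1
    · exact Or.inl (e1 ▸ rfl)
    by_cases e2 : k = j + 1
    · exact Or.inr (e2 ▸ rfl)
    by_cases e3 : k = j
    · exact absurd (e3 ▸ rfl) hy.ne
    · exact absurd hy (h _ _ (by omega) (by omega))
  have six : ∀ i j, i + 2 ≤ j → j + 2 ≤ i + m → ¬ G.Adj c (f i) → ¬ G.Adj c (f j) →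
      HasSixUnits m G f := by
    intro i j h1 h2 hi hj
    obtain ⟨hi1, hi2⟩ := hb i hi
    obtain ⟨hj1, hj2⟩ := hb j hj
    have e1 := isRimUnit_boundary (G := G) (f := f) (j := i - 1) (by rwa [sub_add_cancel])
    have e2 := isRimUnit_boundary (G := G) (f := f) (j := j - 1) (by rwa [sub_add_cancel])
    exact ⟨_, _, _, _, _, _, by omega, by omega, by omega, by omega, by omega, by omega,
      e1, isRimUnit_owned (Or.inl ⟨hi1, hi2⟩), isRimUnit_boundary hi2,
      e2, isRimUnit_owned (Or.inl ⟨hj1, hj2⟩), isRimUnit_boundary hj2⟩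
  by_cases s0 : G.Adj c (f 0) <;> by_cases s2 : G.Adj c (f 2) <;> by_cases s4 : G.Adj c (f 4) <;>
    by_cases s6 : G.Adj c (f 6)
  all_goals first
    | exact (W.false_of_three_spokes hH s0 s2 s4 (by omega) (by omega) (by omega)).elim
    | exact (W.false_of_three_spokes hH s0 s2 s6 (by omega) (by omega) (by omega)).elim
    | exact (W.false_of_three_spokes hH s0 s4 s6 (by omega) (by omega) (by omega)).elim
    | exact (W.false_of_three_spokes hH s2 s4 s6 (by omega) (by omega) (by omega)).elim
    | exact six _ _ (by omega) (by omega) s0 s2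
    | exact six _ _ (by omega) (by omega) s0 s4
    | exact six _ _ (by omega) (by omega) s0 s6
    | exact six _ _ (by omega) (by omega) s2 s4
    | exact six _ _ (by omega) (by omega) s2 s6
    | exact six _ _ (by omega) (by omega) s4 s6

/-- The cycle passes through the center, `f 0`, `f 1` and `f (-1)` in this order. -/
theorem sixUnits_of_spokeEnd_zero (W : IsWheelLabelling m c f) (hH : IsHamCycleGraph G)
    (hG : IsOnePlane G) (hm : 9 ≤ m) (hs0 : G.Adj c (f 0)) (h01 : G.Adj (f 0) (f 1))
    (h11 : G.Adj (f (-1)) (f 1)) : HasSixUnits m G f := by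
  have hlast : f (m - 1) = f (-1) := by rw [show m - 1 = -1 + m by ring, W.add_period]
  have n0 : ∀ y, G.Adj (f 0) y → y = f 1 ∨ y = c := fun y hy =>
    hH.eq_or_eq h01 hs0.symm (W.ne_center 1) hy
  have n1 : ∀ y, G.Adj (f 1) y → y = f 0 ∨ y = f (m - 1) := fun y hy => by
    rw [hlast]
    exact hH.eq_or_eq h01.symm h11.symm
      (fun e => by have := W.inj e (by omega) (by omega); omega) hy
  have t0 : IsRimUnit G f 0 := by
    have := isRimUnit_owned (G := G) (f := f) (j := 0) (Or.inr ⟨by simpa using h11, by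
      right; simpa using h01⟩)
    simpa using this
  have t1 : IsRimUnit G f 1 := by
    have := isRimUnit_boundary (G := G) (f := f) (j := 0) (by simpa using h01)
    simpa using this
  have rep : ∀ y, y ≠ c → ∃ k, 0 ≤ k ∧ k ≤ m - 1 ∧ y = f k := fun y hy => by
    obtain ⟨k, h1, h2, h3⟩ := W.exists_rep 0 hy
    exact ⟨k, h1, by omega, h3⟩
  have spokes : ∀ i j, 0 < i → i < j → j < m → G.Adj c (f i) → G.Adj c (f j) → False :=
    fun i j h1 h2 h3 hi hj => W.false_of_three_spokes hH hs0 hi hj h1 h2 (by omega)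
  -- rim neighbours of the points other than `f 0`, `f 1` avoid these two points
  have inner : ∀ j y, 2 ≤ j → j ≤ m - 2 → G.Adj (f j) y → y = c ∨
      ∃ k, 2 ≤ k ∧ k ≤ m - 1 ∧ y = f k := by
    intro j y h1 h2 hy
    by_cases hyc : y = c
    · exact Or.inl hyc
    obtain ⟨k, h3, h4, rfl⟩ := rep y hyc
    refine Or.inr ⟨k, ?_, h4, rfl⟩
    by_contra hk
    have : k = 0 ∨ k = 1 := by omega
    rcases this with rfl | rfl
    · rcases n0 _ hy.symm with e | e
      · have := W.inj e (by omega) (by omega); omega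
      · exact W.ne_center _ e
    · rcases n1 _ hy.symm with e | e
      · have := W.inj e (by omega) (by omega); omega
      · have := W.inj e (by omega) (by omega); omega
  -- A chord with `f 0` on its short side would cross the spoke to `f 0`, which is already crossed
  -- by the chord from `f (-1)` to `f 1`.
  have chord_len : ∀ x y, 2 ≤ x → x < y → y ≤ m - 1 → G.Adj (f x) (f y) → 2 * (y - x) < m := by
    intro x y h1 h2 h3 h
    by_contra hlen
    have hlen' : m < 2 * (y - x) := by rcases W.odd with ⟨k, hk⟩; omega
    have hxm : G.Adj (f y) (f (x + m)) := by rw [W.add_period]; exact h.symm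
    have h1m : G.Adj (f (m - 1)) (f (1 + m)) := by rw [W.add_period, hlast]; exact h11
    have h0m : G.Adj c (f (0 + m)) := by rw [W.add_period]; exact hs0
    have := W.spoke_crosses_unique hG h0m hxm h1m (by omega) (by omega) (by omega)
      (by omega) (by omega) (by omega)
    omega
  -- Otherwise the center, `f 0`, `f 1` and `f (m - 1)` would already close up into a 4-cycle.
  have hlastc : ¬ G.Adj c (f (m - 1)) := by
    intro hc
    obtain ⟨j, z, h1, h2, h3, h4, h5⟩ := W.exists_leaving hH (a := m - 1) (b := m + 1) (v := c)
      (by omega) (by omega) (fun k _ _ => (W.ne_center k).symm)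
    have hj : j = m - 1 ∨ j = 0 + m ∨ j = 1 + m := by omega
    rcases hj with rfl | rfl | rfl
    · rcases hH.eq_or_eq (hlast ▸ h11 : G.Adj (f (m - 1)) (f 1)) hc.symm (W.ne_center 1) h3 with
        e | e
      · exact h5 (1 + m) (by omega) (by omega) (by rw [e, W.add_period])
      · exact h4 e
    · rw [W.add_period] at h3
      rcases n0 _ h3 with e | e
      · exact h5 (1 + m) (by omega) (by omega) (by rw [e, W.add_period])
      · exact h4 e
    · rw [W.add_period] at h3
      rcases n1 _ h3 with e | e
      · exact h5 (0 + m) (by omega) (by omega) (by rw [e, W.add_period])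
      · exact h5 (m - 1) (by omega) (by omega) e
  -- If the path continues along the boundary, that edge is a third unit and any run over `[2, m -
  -- 2]` completes the six. Otherwise it continues by a chord to some `f x`.
  by_cases hpen : G.Adj (f (m - 1)) (f (m - 2))
  · have nlast : ∀ y, G.Adj (f (m - 1)) y → y = f 1 ∨ y = f (m - 2) := fun y hy =>
      W.eq_or_eq hH (hlast ▸ h11) hpen (by omega) (by omega) hy
    have tlast : IsRimUnit G f (2 * m - 3) := by
      have := isRimUnit_boundary (G := G) (f := f) (j := m - 2)
        (by rw [show m - 2 + 1 = m - 1 by ring]; exact hpen.symm)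
      rwa [show 2 * (m - 2) + 1 = 2 * m - 3 by ring] at this
    have finish : ∀ a b, 2 ≤ a → b ≤ m - 2 → HasUnitRun G f a b → HasSixUnits m G f := by
      rintro a b h1 h2 ⟨u, h3, h4, r1, r2, r3, -⟩
      exact ⟨0, 1, u - 1, u, u + 1, 2 * m - 3, by omega, by omega, by omega, by omega, by omega,
        by omega, t0, t1, r1, r2, r3, tlast⟩
    have inner' : ∀ j y, 2 ≤ j → j ≤ m - 3 → G.Adj (f j) y → y = c ∨
        ∃ k, 2 ≤ k ∧ k ≤ m - 2 ∧ y = f k := by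
      intro j y h1 h2 hy
      rcases inner j y h1 (by omega) hy with h3 | ⟨k, h3, h4, rfl⟩
      · exact Or.inl h3
      refine Or.inr ⟨k, h3, ?_, rfl⟩
      by_contra hk
      obtain rfl : k = m - 1 := by omega
      rcases nlast _ hy.symm with e | e
      · have := W.inj e (by omega) (by omega); omega
      · have := W.inj e (by omega) (by omega); omega
    -- a rim point without chords and without spoke gives a run
    have lonely : ∀ j, 3 ≤ j → j ≤ m - 3 → ¬ G.Adj c (f j) →
        (∀ k, 2 ≤ k → k ≤ m - 2 → G.Adj (f j) (f k) → k = j - 1 ∨ k = j + 1) →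
        HasSixUnits m G f := by
      intro j h1 h2 h3 h4
      have := boundary_of_nbrs hH (f := f) (j := j) fun y hy => by
        rcases inner' j y (by omega) h2 hy with rfl | ⟨k, h5, h6, rfl⟩
        · exact absurd hy.symm h3
        · exact (h4 k h5 h6 hy).imp (congrArg f) (congrArg f)
      exact finish (j - 1) (j + 1) (by omega) (by omega)
        (run_of_owned (by omega) (by omega) this.1 this.2)
    by_cases hch : ∃ x y, 2 ≤ x ∧ x + 2 ≤ y ∧ y ≤ m - 2 ∧ G.Adj (f x) (f y)
    · obtain ⟨x, y, h1, h2, h3, h4⟩ := hch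
      obtain ⟨a, b, h5, h6, hmin⟩ := exists_minimalArc h2 (by omega : y + 2 ≤ x + m) h4
      rcases W.run_or_spokeEnd hH hG hm hmin with hrun | ⟨hb, hab, hq, -⟩
      · exact finish a b (by omega) (by omega) hrun
      obtain ⟨q, rfl⟩ : ∃ q, a = q - 1 := ⟨a + 1, by ring⟩
      obtain rfl : b = q + 1 := by omega
      rw [sub_add_cancel] at hq
      by_cases hch' : ∃ x' y', 2 ≤ x' ∧ x' + 2 ≤ y' ∧ y' ≤ m - 2 ∧ G.Adj (f x') (f y') ∧
          ¬ (x' < q ∧ q < y')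
      · obtain ⟨x', y', g1, g2, g3, g4, g5⟩ := hch'
        obtain ⟨a', b', g6, g7, hmin'⟩ := exists_minimalArc g2 (by omega : y' + 2 ≤ x' + m) g4
        rcases W.run_or_spokeEnd hH hG hm hmin' with hrun | ⟨hb', hab', hq', -⟩
        · exact finish a' b' (by omega) (by omega) hrun
        · exfalso
          rcases lt_trichotomy q (a' + 1) with hlt | heq | hlt
          · exact spokes q (a' + 1) (by omega) hlt (by omega) hq hq'
          · omega
          · exact spokes (a' + 1) q (by omega) hlt (by omega) hq' hq
      -- All remaining chords pass over `q`. The spoke to `f q` admits only one crossing, so the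
      -- chord over `q` just found is the only one.
      push Not at hch'
      have only : ∀ x' y', 2 ≤ x' → x' + 2 ≤ y' → y' ≤ m - 2 → G.Adj (f x') (f y') →
          x' = q - 1 ∧ y' = q + 1 := by
        intro x' y' g1 g2 g3 g4
        have g5 := hch' x' y' g1 g2 g3 g4
        exact W.spoke_crosses_unique hG hq g4 hab (by omega) (by omega)
          (chord_len x' y' g1 (by omega) (by omega) g4) (by omega) (by omega) (by omega)
      -- If the chord missed `f 2`, then `f 3` would be the only possible neighbour of `f 2`.
      have hq3 : q = 3 := by
        by_contra hq3
        have two : ∀ y, G.Adj (f 2) y → y = f 3 := by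
          intro y hy
          rcases inner' 2 y (by omega) (by omega) hy with rfl | ⟨k, g1, g2, rfl⟩
          · exact (spokes 2 q (by omega) (by omega) (by omega) hy.symm hq).elim
          · by_cases e2 : k = 2
            · exact absurd (e2 ▸ rfl) hy.ne
            by_cases e3 : k = 3
            · exact e3 ▸ rfl
            · have := only 2 k (by omega) (by omega) (by omega) hy
              omega
        obtain ⟨y, g1, g2⟩ := hH.exists_other (f 2) (f 3)
        exact g1 (two y g2)
      subst hq3
      -- The only chord joins `f 2` and `f 4`, and both spokes are used at `f 0` and `f 3`. The
      -- position 6 is inside the range because `9 ≤ m`.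
      refine lonely 6 (by omega) (by omega)
        (fun h => spokes 3 6 (by omega) (by omega) (by omega) hq h) fun k g1 g2 g3 => ?_
      by_contra hk
      rcases lt_trichotomy k 6 with g4 | rfl | g4
      · have := only k 6 g1 (by omega) (by omega) g3.symm; omega
      · exact g3.ne rfl
      · have := only 6 k (by omega) (by omega) g2 g3; omega
    · push Not at hch
      have two : G.Adj c (f 2) := by
        by_contra hc2
        have two : ∀ y, G.Adj (f 2) y → y = f 3 := by
          intro y hy
          rcases inner' 2 y (by omega) (by omega) hy with rfl | ⟨k, g1, g2, rfl⟩
          · exact absurd hy.symm hc2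
          · by_cases e2 : k = 2
            · exact absurd (e2 ▸ rfl) hy.ne
            by_cases e3 : k = 3
            · exact e3 ▸ rfl
            · exact absurd hy (hch 2 k (by omega) (by omega) (by omega))
        obtain ⟨y, g1, g2⟩ := hH.exists_other (f 2) (f 3)
        exact g1 (two y g2)
      refine lonely 3 (by omega) (by omega)
        (fun h => spokes 2 3 (by omega) (by omega) (by omega) two h) fun k g1 g2 g3 => ?_
      by_contra hk
      rcases lt_trichotomy k 3 with g4 | rfl | g4
      · omega
      · exact g3.ne rfl
      · exact hch 3 k (by omega) (by omega) g2 g3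
  · obtain ⟨z, hz1, hz⟩ := hH.exists_other (f (m - 1)) (f 1)
    have hzc : z ≠ c := fun e => hlastc (e ▸ hz.symm)
    obtain ⟨x, hx0, hxm, rfl⟩ := rep z hzc
    have hx : 2 ≤ x ∧ x ≤ m - 3 := by
      refine ⟨?_, ?_⟩
      · by_contra hx
        have : x = 0 ∨ x = 1 := by omega
        rcases this with rfl | rfl
        · rcases n0 _ hz.symm with e | e
          · have := W.inj e (by omega) (by omega); omega
          · exact W.ne_center _ e
        · exact hz1 rfl
      · by_contra hx
        have : x = m - 2 ∨ x = m - 1 := by omega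
        rcases this with rfl | rfl
        · exact hpen hz
        · exact hz.ne rfl
    obtain ⟨hx2, hx3⟩ := hx
    have hlen := chord_len x (m - 1) hx2 (by omega) le_rfl hz.symm
    have nlast : ∀ y, G.Adj (f (m - 1)) y → y = f 1 ∨ y = f x := fun y hy =>
      W.eq_or_eq hH (hlast ▸ h11) hz (by omega) (by omega) hy
    -- The arc `[x, m - 1]` supplies a run, so a single further unit below it is enough.
    have finish : ∀ u, 2 ≤ u → u ≤ 2 * x - 1 → IsRimUnit G f u → HasSixUnits m G f := by
      intro u h1 h2 tu
      obtain ⟨a, b, h5, h6, hmin⟩ := exists_minimalArc (by omega)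
        (by omega : m - 1 + 2 ≤ x + m) hz.symm
      rcases W.run_or_spokeEnd hH hG hm hmin with ⟨v, h3, h4, r1, r2, r3, -⟩ | ⟨hb, hab, hq, hor⟩
      · exact ⟨0, 1, u, v - 1, v, v + 1, by omega, by omega, by omega, by omega, by omega,
          by omega, t0, t1, tu, r1, r2, r3⟩
      -- A spoke end here would have to be the whole arc `[x, m - 1]`, with `x = m - 3`. The cycle
      -- would then close after the center, `f 0`, `f 1`, `f (m - 1)`, `f (m - 3)`, `f (m - 2)`.
      exfalso
      have := W.spoke_crosses_unique hG hq hab hz.symm (by omega) (by omega) (by omega)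
        (by omega) (by omega) hlen
      obtain ⟨rfl, rfl⟩ := this
      obtain rfl : a = m - 3 := by omega
      rw [show m - 3 + 1 = m - 2 by ring] at hq hor
      have h32 : G.Adj (f (m - 3)) (f (m - 2)) := by
        refine hor.resolve_right fun h => hpen h.symm
      obtain ⟨j, z, g1, g2, g3, g4, g5⟩ := W.exists_leaving hH (a := m - 3) (b := m + 1) (v := c)
        (by omega) (by omega) (fun k _ _ => (W.ne_center k).symm)
      have hj : j = m - 3 ∨ j = m - 2 ∨ j = m - 1 ∨ j = 0 + m ∨ j = 1 + m := by omega
      rcases hj with rfl | rfl | rfl | rfl | rfl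
      · rcases W.eq_or_eq hH h32 hz.symm (by omega) (by omega) g3 with e | e
        · exact g5 (m - 2) (by omega) (by omega) e
        · exact g5 (m - 1) (by omega) (by omega) e
      · rcases hH.eq_or_eq h32.symm hq.symm (W.ne_center _) g3 with e | e
        · exact g5 (m - 3) (by omega) (by omega) e
        · exact g4 e
      · rcases nlast _ g3 with e | e
        · exact g5 (1 + m) (by omega) (by omega) (by rw [e, W.add_period])
        · exact g5 (m - 3) (by omega) (by omega) e
      · rw [W.add_period] at g3
        rcases n0 _ g3 with e | e
        · exact g5 (1 + m) (by omega) (by omega) (by rw [e, W.add_period])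
        · exact g4 e
      · rw [W.add_period] at g3
        rcases n1 _ g3 with e | e
        · exact g5 (0 + m) (by omega) (by omega) (by rw [e, W.add_period])
        · exact g5 (m - 1) (by omega) (by omega) e
    by_cases hch : ∃ y y', 2 ≤ y ∧ y + 2 ≤ y' ∧ y' ≤ x ∧ G.Adj (f y) (f y')
    · obtain ⟨y, y', h1, h2, h3, h4⟩ := hch
      obtain ⟨a, b, h5, h6, hmin⟩ := exists_minimalArc h2 (by omega : y' + 2 ≤ y + m) h4
      rcases W.run_or_spokeEnd hH hG hm hmin with ⟨v, h7, h8, r1, r2, r3, -⟩ | ⟨rfl, hab, hq, hor⟩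
      · exact finish v (by omega) (by omega) r2
      · refine finish (2 * (a + 1)) (by omega) (by omega) (isRimUnit_owned (Or.inr ?_))
        rw [add_sub_cancel_right, show a + 1 + 1 = a + 2 by ring]
        exact ⟨hab, hor⟩
    push Not at hch
    by_cases h23 : G.Adj (f 2) (f 3)
    · exact finish (2 * 2 + 1) (by omega) (by omega) (isRimUnit_boundary h23)
    exfalso
    -- edges from the points below `x` to points above it cross the chord `{x, m - 1}`
    have far : ∀ j y, 2 ≤ j → j < x → G.Adj (f j) y → y = c ∨ y = f (j - 1) ∨ y = f (j + 1) ∨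
        ∃ k, x < k ∧ k < m - 1 ∧ y = f k := by
      intro j y h1 h2 hy
      rcases inner j y h1 (by omega) hy with h3 | ⟨k, h3, h4, rfl⟩
      · exact Or.inl h3
      right
      by_cases e1 : k = j - 1
      · exact Or.inl (e1 ▸ rfl)
      by_cases e2 : k = j + 1
      · exact Or.inr (Or.inl (e2 ▸ rfl))
      refine Or.inr (Or.inr ⟨k, ?_, ?_, rfl⟩)
      · by_contra hk
        rcases lt_trichotomy k j with h5 | rfl | h5
        · exact hch k j h3 (by omega) (by omega) hy.symm
        · exact hy.ne rfl
        · exact hch j k h1 (by omega) (by omega) hy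
      · by_contra hk
        obtain rfl : k = m - 1 := by omega
        rcases nlast _ hy.symm with e | e
        · have := W.inj e (by omega) (by omega); omega
        · have := W.inj e (by omega) (by omega); omega
    have uniq : ∀ j j' k k', 2 ≤ j → j < x → 2 ≤ j' → j' < x → x < k → k < m - 1 → x < k' →
        k' < m - 1 → G.Adj (f j) (f k) → G.Adj (f j') (f k') → j = j' ∧ k = k' := by
      intro j j' k k' h1 h2 h3 h4 h5 h6 h7 h8 h9 h10
      have := W.leaving_unique hG (by omega) hz.symm h5 h6 h9.symm
        (fun i hi hi' e => by have := W.inj e (by omega) (by omega); omega)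
        (fun e => absurd e (W.ne_center _)) h7 h8 h10.symm
        (fun i hi hi' e => by have := W.inj e (by omega) (by omega); omega)
        (fun e => absurd e (W.ne_center _))
      exact ⟨W.inj this.2 (by omega) (by omega), this.1⟩
    have two : ∀ y, G.Adj (f 2) y → y = c ∨ ∃ k, x < k ∧ k < m - 1 ∧ y = f k := by
      intro y hy
      rcases far 2 y (by omega) (by omega) hy with h1 | rfl | rfl | h1
      · exact Or.inl h1
      · rcases inner 2 _ (by omega) (by omega) hy with e | ⟨k, h2, h3, e⟩
        · exact absurd e (W.ne_center _)
        · have := W.inj e (by omega) (by omega); omega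
      · exact absurd hy h23
      · exact Or.inr h1
    -- Only one edge may cross the chord from `f x` to `f (m - 1)`, so `f 2` has one such edge and a
    -- spoke. That exhausts the crossing and the spokes, and leaves `f 3` no neighbour besides `f
    -- 4`.
    obtain ⟨y₁, hy₁, h2y₁⟩ := hH.exists_other (f 2) c
    obtain ⟨k₁, g1, g2, rfl⟩ := (two y₁ h2y₁).resolve_left hy₁
    obtain ⟨y₂, hy₂, h2y₂⟩ := hH.exists_other (f 2) (f k₁)
    have hc2 : G.Adj c (f 2) := by
      rcases two y₂ h2y₂ with rfl | ⟨k₂, g3, g4, rfl⟩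
      · exact h2y₂.symm
      · have := uniq 2 2 k₁ k₂ (by omega) (by omega) (by omega) (by omega) g1 g2 g3 g4 h2y₁ h2y₂
        exact absurd (by rw [this.2]) hy₂
    obtain ⟨y₃, hy₃, h3y₃⟩ := hH.exists_other (f 3) (f 4)
    rcases far 3 y₃ (by omega) (by omega) h3y₃ with rfl | rfl | rfl | ⟨k₃, g3, g4, rfl⟩
    · exact spokes 2 3 (by omega) (by omega) (by omega) hc2 h3y₃.symm
    · exact h23 h3y₃.symm
    · exact hy₃ rfl
    · have := uniq 2 3 k₁ k₃ (by omega) (by omega) (by omega) (by omega) g1 g2 g3 g4 h2y₁ h3y₃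
      omega

theorem sixUnits_of_spokeEnd (W : IsWheelLabelling m c f) (hH : IsHamCycleGraph G)
    (hG : IsOnePlane G) (hm : 9 ≤ m) {a b : ℤ} (h : IsSpokeEnd G c f a b) :
    HasSixUnits m G f := by
  obtain ⟨rfl, hab, hs, hor⟩ := h
  rcases hor with hor | hor
  · apply HasSixUnits.of_translate (d := a + 1)
    apply HasSixUnits.of_reflect
    refine (W.translate (a + 1)).reflect.sixUnits_of_spokeEnd_zero hH hG hm ?_ ?_ ?_
    · simpa using hs
    · simpa [show -1 + (a + 1) = a by ring] using hor.symm
    · simpa [show -1 + (a + 1) = a by ring, show 1 + (a + 1) = a + 2 by ring] using hab.symm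
  · apply HasSixUnits.of_translate (d := a + 1)
    refine (W.translate (a + 1)).sixUnits_of_spokeEnd_zero hH hG hm ?_ ?_ ?_
    · simpa using hs
    · simpa [show 1 + (a + 1) = a + 2 by ring] using hor
    · simpa [show -1 + (a + 1) = a by ring, show 1 + (a + 1) = a + 2 by ring] using hab

/-- Every 1-plane Hamiltonian cycle on a wheel with at least nine rim points has six units. -/
theorem hasSixUnits (W : IsWheelLabelling m c f) (hH : IsHamCycleGraph G)
    (hG : IsOnePlane G) (hm : 9 ≤ m) : HasSixUnits m G f := by
  by_cases hch : ∃ a b, a + 2 ≤ b ∧ b + 2 ≤ a + m ∧ G.Adj (f a) (f b)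
  swap
  · push Not at hch
    exact W.sixUnits_of_no_chord hH hm hch
  obtain ⟨a, b, h1, h2, h3⟩ := hch
  -- The complementary arc of the same chord runs from `b` to `a + m`.
  have h3' : G.Adj (f b) (f (a + m)) := by rw [W.add_period]; exact h3.symm
  obtain ⟨a₁, b₁, h4, h5, hmin₁⟩ := exists_minimalArc h1 h2 h3
  obtain ⟨a₂, b₂, h6, h7, hmin₂⟩ := exists_minimalArc (by omega)
    (by omega : a + m + 2 ≤ b + m) h3'
  rcases W.run_or_spokeEnd hH hG hm hmin₁ with ⟨u, u1, u2, t1, t2, t3, ua, ub⟩ | h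
  swap
  · exact W.sixUnits_of_spokeEnd hH hG hm h
  rcases W.run_or_spokeEnd hH hG hm hmin₂ with ⟨v, v1, v2, s1, s2, s3, va, vb⟩ | h
  swap
  · exact W.sixUnits_of_spokeEnd hH hG hm h
  -- Runs on the two sides can overlap only at an end of the original chord. The end conditions in
  -- `HasUnitRun` would then give that point more than two neighbours.
  have no_common : ∀ w, ¬ ((G.Adj (f w) (f (w + 1)) ∧ G.Adj (f w) (f (w + 2))) ∧
      (G.Adj (f w) (f (w - 1)) ∧ G.Adj (f w) (f (w - 2)))) := by
    rintro w ⟨⟨e1, e2⟩, e3, -⟩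
    rcases W.eq_or_eq hH e1 e2 (by omega) (by omega) e3 with e | e
    · have := W.inj e (by omega) (by omega); omega
    · have := W.inj e (by omega) (by omega); omega
  have g1 : u + 1 < v - 1 := by
    by_contra hcon
    obtain rfl : b₁ = b := by omega
    obtain rfl : a₂ = b₁ := by omega
    exact no_common _ ⟨va (by omega), ub (by omega)⟩
  have g2 : v + 1 < u - 1 + 2 * m := by
    by_contra hcon
    obtain rfl : b₂ = a + m := by omega
    obtain rfl : a₁ = a := by omega
    have := vb (by omega)
    rw [W.add_period, show a₁ + m - 1 = a₁ - 1 + m by ring, W.add_period,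
      show a₁ + m - 2 = a₁ - 2 + m by ring, W.add_period] at this
    exact no_common _ ⟨ua (by omega), this⟩
  exact ⟨u - 1, u, u + 1, v - 1, v, v + 1, by omega, by omega, g1, by omega, by omega, g2,
    t1, t2, t3, s1, s2, s3⟩

end IsWheelLabelling

end SixUnits

/-! ### Upper bound: counting units -/

section Counting

variable {m : ℤ} {P : Finset ℂ} {c : P} {f : ℤ → P}

/-- Graphs without a common edge have no common unit. -/
theorem IsRimUnit.not_disjoint {G G' : SimpleGraph P} {u : ℤ} (h : IsRimUnit G f u)
    (h' : IsRimUnit G' f u) : ¬ Disjoint G.edgeSet G'.edgeSet := by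
  intro hd
  have key : ∀ x y, G.Adj x y → ¬ G'.Adj x y := fun x y h1 h2 =>
    Set.disjoint_left.1 hd (G.mem_edgeSet.2 h1) (G'.mem_edgeSet.2 h2)
  rcases h with ⟨j, rfl, h⟩ | ⟨j, rfl, h⟩ <;> rcases h' with ⟨j', e, h'⟩ | ⟨j', e, h'⟩
  · obtain rfl : j = j' := by omega
    have k1 := key (f (j - 1)) (f j)
    have k2 := key (f j) (f (j + 1))
    have k3 := key (f (j - 1)) (f (j + 1))
    unfold OwnsRim at h h'
    -- Each graph has two of the three edges of the triangle on `j - 1`, `j`, `j + 1`, so one is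
    -- shared.
    tauto
  · omega
  · omega
  · obtain rfl : j = j' := by omega
    exact key _ _ h h'

theorem IsRimUnit.add_mul_period (W : IsWheelLabelling m c f) {G : SimpleGraph P} {u : ℤ}
    (h : IsRimUnit G f u) (k : ℤ) : IsRimUnit G f (u + 2 * m * k) := by
  have hper : (fun i => f (i + m * k)) = f :=
    funext fun i => (W.eq_iff _ _).2 ⟨k, by ring⟩
  have h2 := IsRimUnit.of_translate (G := G) (f := f) (u := u) (d := m * k) (by rwa [hper])
  rwa [← mul_assoc] at h2

/-- The `6 * k` units are pairwise distinct modulo `2 * m`: within one cycle because they lie in one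
turn, between cycles by edge-disjointness. -/
theorem IsWheelLabelling.packing_le (W : IsWheelLabelling m c f) (hm : 9 ≤ m) {k : ℕ}
    (h : HasOnePHCPacking P k) : 3 * (k : ℤ) ≤ m := by
  obtain ⟨C, hC, hdisj⟩ := h
  have hsix : ∀ i, ∃ u : Fin 6 → ℤ, StrictMono u ∧ u 5 < u 0 + 2 * m ∧
      ∀ t, IsRimUnit (C i) f (u t) := by
    intro i
    obtain ⟨u₁, u₂, u₃, u₄, u₅, u₆, h1, h2, h3, h4, h5, h6, t1, t2, t3, t4, t5, t6⟩ :=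
      W.hasSixUnits (hC i).1 (hC i).2 hm
    refine ⟨![u₁, u₂, u₃, u₄, u₅, u₆], Fin.strictMono_iff_lt_succ.2 ?_, h6, ?_⟩
    · intro t; fin_cases t <;> assumption
    · intro t; fin_cases t <;> assumption
  choose u hmono hlast hunit using hsix
  have hpos : 0 < 2 * m := by omega
  have hinj : ∀ i i' t t', 2 * m ∣ u i t - u i' t' → i = i' ∧ t = t' := by
    rintro i i' t t' ⟨q, hq⟩
    obtain rfl : i = i' := by
      by_contra hne
      refine IsRimUnit.not_disjoint (hunit i t) ?_ (hdisj i i' hne)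
      have := (hunit i' t').add_mul_period W q
      rwa [← hq, add_sub_cancel] at this
    refine ⟨rfl, (hmono i).injective ?_⟩
    have b1 := (hmono i).monotone (Fin.zero_le t)
    have b2 := (hmono i).monotone (Fin.le_last t)
    have b3 := (hmono i).monotone (Fin.zero_le t')
    have b4 := (hmono i).monotone (Fin.le_last t')
    have b5 := hlast i
    change u i t ≤ u i 5 at b2
    change u i t' ≤ u i 5 at b4
    have : q < 1 := by nlinarith
    have : -1 < q := by nlinarith
    obtain rfl : q = 0 := by omega
    linarith
  let g : Fin k × Fin 6 → ℤ := fun p => u p.1 p.2 % (2 * m)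
  have hg : Function.Injective g := by
    rintro ⟨i, t⟩ ⟨i', t'⟩ e
    obtain ⟨h1, h2⟩ := hinj i i' t t' (Int.ModEq.dvd (Int.ModEq.symm e))
    rw [h1, h2]
  have hcard := Finset.card_le_card_of_injOn (s := Finset.univ) (t := Finset.Ico 0 (2 * m)) g
    (fun p _ => by
      simp only [Finset.coe_Ico, Set.mem_Ico]
      exact ⟨Int.emod_nonneg _ hpos.ne', Int.emod_lt_of_pos _ hpos⟩) hg.injOn
  simp only [Finset.card_univ, Fintype.card_prod, Fintype.card_fin, Int.card_Ico, sub_zero]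
    at hcard
  omega

end Counting

/-! ### Lower bound: zigzag cycles -/

/-- The graph formed by the first `n` steps of a sequence of points. -/
def sequenceGraph {P : Finset ℂ} (n : ℕ) (g : ℕ → P) : SimpleGraph P :=
  SimpleGraph.fromEdgeSet {e | ∃ j < n, e = s(g j, g (j + 1))}

theorem exists_walk_of_sequence {P : Finset ℂ} (g : ℕ → P) (k : ℕ)
    (hg : ∀ j < k, g j ≠ g (j + 1)) :
    ∃ w : (⊤ : SimpleGraph P).Walk (g 0) (g k),
      w.support = (List.range (k + 1)).map g ∧
      w.edges = (List.range k).map fun j => s(g j, g (j + 1)) := by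
  induction k with
  | zero => exact ⟨SimpleGraph.Walk.nil, by simp, by simp⟩
  | succ k ih =>
    obtain ⟨w, h1, h2⟩ := ih fun j hj => hg j (by omega)
    refine ⟨w.concat ((SimpleGraph.top_adj _ _).2 (hg k (by omega))), ?_, ?_⟩
    · rw [SimpleGraph.Walk.support_concat, h1, List.range_succ (n := k + 1)]; simp
    · rw [SimpleGraph.Walk.edges_concat, h2, List.range_succ (n := k)]; simp

theorem isHamCycleGraph_sequenceGraph {P : Finset ℂ} {n : ℕ} {g : ℕ → P} (hn : 3 ≤ n)
    (hcard : P.card = n) (hclosed : g n = g 0)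
    (hinj : ∀ i j, i < n → j < n → g i = g j → i = j) :
    IsHamCycleGraph (sequenceGraph n g) := by
  classical
  -- The tail of the support is indexed by `1, …, n`, so injectivity is moved there, with `n` in the
  -- role of `0`.
  have hinj' : ∀ i j, 0 < i → i ≤ n → 0 < j → j ≤ n → g i = g j → i = j := by
    intro i j h1 h2 h3 h4 h
    rcases eq_or_lt_of_le h2 with rfl | h2 <;> rcases eq_or_lt_of_le h4 with h4 | h4
    · exact h4.symm
    · have := hinj 0 j (by omega) h4 (hclosed ▸ h); omega
    · subst h4
      have := hinj i 0 h2 (by omega) (hclosed ▸ h); omega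
    · exact hinj i j h2 h4 h
  have hne : ∀ j < n, g j ≠ g (j + 1) := by
    intro j hj h
    by_cases h0 : j = 0
    · subst h0
      have := hinj 0 1 (by omega) (by omega) h; omega
    · have := hinj' j (j + 1) (by omega) (by omega) (by omega) (by omega) h; omega
  obtain ⟨w, hs, he⟩ := exists_walk_of_sequence g n hne
  have hlen : (w.copy rfl hclosed).length = n := by
    rw [SimpleGraph.Walk.length_copy, ← SimpleGraph.Walk.length_edges, he]; simp
  refine ⟨g 0, w.copy rfl hclosed, ?_, ?_⟩
  · rw [SimpleGraph.Walk.isHamiltonianCycle_iff_isCycle_and_length_eq]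
    refine ⟨?_, by rw [hlen]; simp [hcard]⟩
    rw [SimpleGraph.Walk.isCycle_def]
    refine ⟨?_, ?_, ?_⟩
    · rw [SimpleGraph.Walk.isTrail_def, SimpleGraph.Walk.edges_copy, he]
      refine List.Nodup.map_on ?_ List.nodup_range
      intro i hi j hj h
      rw [List.mem_range] at hi hj
      rcases Sym2.eq_iff.1 h with ⟨h1, -⟩ | ⟨h1, h2⟩
      · exact hinj i j hi hj h1
      · exfalso
        by_cases h0 : i = 0
        · subst h0
          have e1 := hinj' 1 j (by omega) (by omega)
            (Nat.pos_of_ne_zero fun h => by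
              subst h; have := hinj 1 0 (by omega) (by omega) h2; omega) (by omega) h2
          subst e1
          have := hinj 0 2 (by omega) (by omega) h1
          omega
        · have e1 := hinj' i (j + 1) (by omega) (by omega) (by omega) (by omega) h1
          by_cases h0' : j = 0
          · subst h0'
            subst e1
            have := hinj 2 0 (by omega) (by omega) h2
            omega
          · have := hinj' (i + 1) j (by omega) (by omega) (by omega) (by omega) h2
            omega
    · intro h
      have := congrArg SimpleGraph.Walk.length h
      rw [hlen] at this
      simp at this; omega
    · rw [SimpleGraph.Walk.support_copy, hs, ← List.map_tail]
      refine List.Nodup.map_on ?_ (List.nodup_range.tail)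
      have htail : (List.range (n + 1)).tail = (List.range n).map Nat.succ := by
        rw [List.range_succ_eq_map]; rfl
      rw [htail]
      simp only [List.mem_map, List.mem_range]
      rintro _ ⟨i, hi, rfl⟩ _ ⟨j, hj, rfl⟩ h
      exact hinj' _ _ (by omega) (by omega) (by omega) (by omega) h
  · rw [sequenceGraph, SimpleGraph.edgeSet_fromEdgeSet, SimpleGraph.Walk.edges_copy, he]
    ext e
    simp only [Set.mem_sdiff, Set.mem_ofPred_eq, List.mem_map, List.mem_range]
    constructor
    · rintro ⟨⟨j, hj, rfl⟩, -⟩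
      exact ⟨j, hj, rfl⟩
    · rintro ⟨j, hj, rfl⟩
      exact ⟨⟨j, hj, rfl⟩, by simpa using hne j hj⟩

/-- The position at time `t` of the zigzag over the rim positions `-h, …, h` that starts at
`-(i + 1)` and stops at `i`. -/
def zigzag (h i t : ℤ) : ℤ :=
  if i + t ≤ h then (if t % 2 = 0 then i + t else -(i + t))
  else (if t % 2 = 0 then 2 * h + 1 - (i + t) else i + t - (2 * h + 1))

/-- The rim chords of a zigzag cycle, in coordinates `-h, …, h`. -/
def IsZigzagChord (h i a b : ℤ) : Prop :=
  -h ≤ a ∧ a < b ∧ b ≤ h ∧ (a + b = 1 ∨ (a + b = -1 ∧ b ≠ i) ∨ (a = -h ∧ b = h))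

section Zigzag

variable {P : Finset ℂ}

/-- The closed sequence that goes from the center around the zigzag based at position `s`. -/
def zigzagSequence (c : P) (f : ℤ → P) (h i s : ℤ) (j : ℕ) : P :=
  if j = 0 ∨ 2 * h + 1 < j then c else f (s + zigzag h i j)

/-- The Hamiltonian cycle that runs along a zigzag and through the center. -/
def zigzagCycle (c : P) (f : ℤ → P) (h i s : ℤ) : SimpleGraph P :=
  sequenceGraph (2 * h + 2).toNat (zigzagSequence c f h i s)

/-- The positions alternate outward until one of `-h`, `h` is reached, use the boundary edge between
these two, and come back through `0` to `i`. The chord from `-(i + 1)` to `i` is the one left out;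
the detour through the center replaces it. -/
theorem zigzag_step {h i t : ℤ} (hi : 0 ≤ i) (hih : i < h) (h1 : 1 ≤ t) (h2 : t ≤ 2 * h) :
    IsZigzagChord h i (zigzag h i t) (zigzag h i (t + 1)) ∨
    IsZigzagChord h i (zigzag h i (t + 1)) (zigzag h i t) := by
  unfold IsZigzagChord zigzag
  split_ifs <;> omega

theorem mem_edgeSet_zigzagCycle {c : P} {f : ℤ → P} {h i s : ℤ} (hi : 0 ≤ i) (hih : i < h)
    {e : Sym2 P} (he : e ∈ (zigzagCycle c f h i s).edgeSet) :
    (∃ a b, IsZigzagChord h i a b ∧ e = s(f (s + a), f (s + b))) ∨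
    ∃ z, (z = i ∨ z = -(i + 1)) ∧ e = s(c, f (s + z)) := by
  rw [zigzagCycle, sequenceGraph, SimpleGraph.edgeSet_fromEdgeSet] at he
  obtain ⟨⟨j, hj, rfl⟩, -⟩ := he
  have hj' : (j : ℤ) < 2 * h + 2 := by omega
  by_cases h0 : j = 0
  · right
    refine ⟨-(i + 1), Or.inr rfl, ?_⟩
    have e1 : zigzagSequence c f h i s j = c := if_pos (Or.inl h0)
    have e2 : zigzagSequence c f h i s (j + 1) = f (s + zigzag h i (j + 1 : ℕ)) :=
      if_neg (by omega)
    have e3 : zigzag h i (j + 1 : ℕ) = -(i + 1) := by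
      subst h0; unfold zigzag; push_cast; split_ifs <;> omega
    rw [e1, e2, e3]
  have e1 : zigzagSequence c f h i s j = f (s + zigzag h i j) := if_neg (by omega)
  by_cases h3 : (j : ℤ) = 2 * h + 1
  · right
    refine ⟨i, Or.inl rfl, ?_⟩
    have e2 : zigzagSequence c f h i s (j + 1) = c := if_pos (by omega)
    have e3 : zigzag h i j = i := by
      rw [h3]; unfold zigzag; split_ifs <;> omega
    rw [e1, e2, e3, Sym2.eq_swap]
  · left
    have e2 : zigzagSequence c f h i s (j + 1) = f (s + zigzag h i (j + 1 : ℕ)) :=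
      if_neg (by omega)
    rw [e1, e2]
    push_cast
    rcases zigzag_step (t := j) hi hih (by omega) (by omega) with h4 | h4
    · exact ⟨_, _, h4, rfl⟩
    · exact ⟨_, _, h4, Sym2.eq_swap⟩

theorem zigzag_bounds {h i t : ℤ} (hi : 0 ≤ i) (h1 : 1 ≤ t) (h2 : t ≤ 2 * h + 1)
    (hih : i < h) : -h ≤ zigzag h i t ∧ zigzag h i t ≤ h := by
  unfold zigzag; split_ifs <;> omega

theorem zigzag_injective {h i t t' : ℤ} (hi : 0 ≤ i) (h1 : 1 ≤ t)
    (h2 : t ≤ 2 * h + 1) (h1' : 1 ≤ t') (h2' : t' ≤ 2 * h + 1)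
    (he : zigzag h i t = zigzag h i t') : t = t' := by
  unfold zigzag at he; split_ifs at he <;> omega

namespace IsWheelLabelling

variable {m : ℤ} {c : P} {f : ℤ → P} {h i s : ℤ}

theorem isHamCycleGraph_zigzagCycle (W : IsWheelLabelling m c f) (hm : m = 2 * h + 1)
    (hcard : (P.card : ℤ) = m + 1) (hi : 0 ≤ i) (hih : i < h) :
    IsHamCycleGraph (zigzagCycle c f h i s) := by
  have hrim : ∀ j : ℕ, j ≠ 0 → (j : ℤ) < 2 * h + 2 →
      zigzagSequence c f h i s j = f (s + zigzag h i j) := fun j h1 h2 => if_neg (by omega)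
  refine isHamCycleGraph_sequenceGraph (by omega) (by omega) ?_ ?_
  · have e1 : zigzagSequence c f h i s (2 * h + 2).toNat = c := if_pos (by omega)
    have e2 : zigzagSequence c f h i s 0 = c := if_pos (Or.inl rfl)
    rw [e1, e2]
  · intro j j' hj hj' e
    by_cases h0 : j = 0 <;> by_cases h0' : j' = 0
    · omega
    · subst h0
      rw [hrim j' h0' (by omega), show zigzagSequence c f h i s 0 = c from if_pos (Or.inl rfl)] at e
      exact absurd e.symm (W.ne_center _)
    · subst h0'
      rw [hrim j h0 (by omega), show zigzagSequence c f h i s 0 = c from if_pos (Or.inl rfl)] at e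
      exact absurd e (W.ne_center _)
    · rw [hrim j h0 (by omega), hrim j' h0' (by omega)] at e
      have b1 := zigzag_bounds (h := h) (t := j) hi (by omega) (by omega) hih
      have b2 := zigzag_bounds (h := h) (t := j') hi (by omega) (by omega) hih
      have := W.inj e (by omega) (by omega)
      have := zigzag_injective (h := h) (t := j) (t' := j') hi (by omega) (by omega) (by omega)
        (by omega) (by omega)
      omega

/-- Chords with equal end sum are parallel, and a chord of sum `-1` meets only its shift by one in
the class of sum `1`. So every chord has at most one partner. -/
theorem zigzag_chords_cross (W : IsWheelLabelling m c f) (hm : m = 2 * h + 1) {a b x y : ℤ}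
    (hab : IsZigzagChord h i a b) (hxy : IsZigzagChord h i x y)
    (hc : EdgesCross s(f (s + a), f (s + b)) s(f (s + x), f (s + y))) :
    (a + b = -1 ∧ x = a + 1 ∧ y = b + 1) ∨ (a + b = 1 ∧ x = a - 1 ∧ y = b - 1) := by
  unfold IsZigzagChord at hab hxy
  have := W.of_chord_cross (s - h) _ _ _ _ (by omega) (by omega) (by omega) (by omega) (by omega)
    (by omega) hc
  omega

/-- With this `i` the chord from `-i` to `i + 1` has length `h` or `h + 1`, the lengths closest to
half the rim. Shorter zigzag chords do not reach over the spoke ends, and longer ones have the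
center and both spoke ends on one side. -/
theorem zigzag_spoke_cross (W : IsWheelLabelling m c f) (hm : m = 2 * h + 1)
    (hi : 0 ≤ i) (hih : i < h) (hL : 2 * i + 1 = h ∨ 2 * i = h) {a b z : ℤ}
    (hab : IsZigzagChord h i a b) (hz : z = i ∨ z = -(i + 1))
    (hc : EdgesCross s(f (s + a), f (s + b)) s(c, f (s + z))) :
    a = -i ∧ b = i + 1 ∧ (2 * i + 1 = h ↔ z = i) := by
  unfold IsZigzagChord at hab
  have := W.of_spoke_cross (s - h) _ _ _ (by omega) (by omega) (by omega) (by omega) (by omega) hc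
  omega

/-- The only chord crossed by a spoke is the one from `-i` to `i + 1`, and its partner is precisely
the chord that was left out. -/
theorem isOnePlane_zigzagCycle (W : IsWheelLabelling m c f) (hm : m = 2 * h + 1)
    (hi : 0 ≤ i) (hih : i < h) (hL : 2 * i + 1 = h ∨ 2 * i = h) :
    IsOnePlane (zigzagCycle c f h i s) := by
  intro e he
  rw [Set.encard_le_one_iff]
  rintro e₁ e₂ ⟨he₁, hc₁⟩ ⟨he₂, hc₂⟩
  rcases mem_edgeSet_zigzagCycle hi hih he with ⟨a, b, hab, rfl⟩ | ⟨z, hz, rfl⟩ <;>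
  rcases mem_edgeSet_zigzagCycle hi hih he₁ with ⟨a₁, b₁, hab₁, rfl⟩ | ⟨z₁, hz₁, rfl⟩ <;>
  rcases mem_edgeSet_zigzagCycle hi hih he₂ with ⟨a₂, b₂, hab₂, rfl⟩ | ⟨z₂, hz₂, rfl⟩
  · have h1 := W.zigzag_chords_cross hm hab hab₁ hc₁
    have h2 := W.zigzag_chords_cross hm hab hab₂ hc₂
    obtain rfl : a₁ = a₂ := by omega
    obtain rfl : b₁ = b₂ := by omega
    rfl
  · have h1 := W.zigzag_chords_cross hm hab hab₁ hc₁
    have h2 := W.zigzag_spoke_cross hm hi hih hL hab hz₂ hc₂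
    unfold IsZigzagChord at hab₁
    omega
  · have h1 := W.zigzag_spoke_cross hm hi hih hL hab hz₁ hc₁
    have h2 := W.zigzag_chords_cross hm hab hab₂ hc₂
    unfold IsZigzagChord at hab₂
    omega
  · have h1 := W.zigzag_spoke_cross hm hi hih hL hab hz₁ hc₁
    have h2 := W.zigzag_spoke_cross hm hi hih hL hab hz₂ hc₂
    obtain rfl : z₁ = z₂ := by omega
    rfl
  · have h1 := W.zigzag_spoke_cross hm hi hih hL hab₁ hz hc₁.symm
    have h2 := W.zigzag_spoke_cross hm hi hih hL hab₂ hz hc₂.symm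
    rw [h1.1, h1.2.1, h2.1, h2.2.1]
  · exact absurd hc₂ (W.not_spokes_cross _ _)
  · exact absurd hc₁ (W.not_spokes_cross _ _)
  · exact absurd hc₁ (W.not_spokes_cross _ _)

/-- Since `2 * (h + 1) = m + 1`, twice the base point is `3 * t` modulo `m`, so the end sums of the
chords lie in `3 * t + {-1, 0, 1}`. The doubled positions of the two spoke ends are consecutive
modulo `m`. A common edge would thus make `3 * (t - t')` congruent to some `d` with `|d| ≤ 2`. -/
theorem disjoint_zigzagCycle (W : IsWheelLabelling m c f) (hm : m = 2 * h + 1)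
    (hi : 0 ≤ i) (hih : i < h) (hL : 2 * i + 1 = h ∨ 2 * i = h) {t t' : ℤ} (hne : t ≠ t')
    (h1 : 3 * (t - t') + 3 ≤ m) (h2 : 3 * (t' - t) + 3 ≤ m) :
    Disjoint (zigzagCycle c f h i (3 * t * (h + 1))).edgeSet
      (zigzagCycle c f h i (3 * t' * (h + 1))).edgeSet := by
  have key : ∀ d, -2 ≤ d → d ≤ 2 → ¬ m ∣ 3 * (t - t') + d := by
    rintro d h3 h4 ⟨q, hq⟩
    have : q < 1 := by nlinarith
    have : -1 < q := by nlinarith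
    obtain rfl : q = 0 := by omega
    omega
  have hs : ∀ x y, m ∣ 2 * (3 * t * (h + 1)) + x - (2 * (3 * t' * (h + 1)) + y) →
      m ∣ 3 * (t - t') + (x - y) := by
    intro x y hd
    have e : 3 * (t - t') + (x - y) =
        2 * (3 * t * (h + 1)) + x - (2 * (3 * t' * (h + 1)) + y) - m * (3 * (t - t')) := by
      rw [hm]; ring
    rw [e]
    exact dvd_sub hd (dvd_mul_right _ _)
  rw [Set.disjoint_left]
  intro e he he'
  rcases mem_edgeSet_zigzagCycle hi hih he with ⟨a, b, hab, rfl⟩ | ⟨z, hz, rfl⟩ <;>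
  rcases mem_edgeSet_zigzagCycle hi hih he' with ⟨a', b', hab', h'⟩ | ⟨z', hz', h'⟩
  · have hsum : m ∣ 2 * (3 * t * (h + 1)) + (a + b) - (2 * (3 * t' * (h + 1)) + (a' + b')) := by
      rcases Sym2.eq_iff.1 h' with ⟨e1, e2⟩ | ⟨e1, e2⟩
      · rw [W.eq_iff] at e1 e2
        have := dvd_add e1 e2
        ring_nf at this ⊢; exact this
      · rw [W.eq_iff] at e1 e2
        have := dvd_add e1 e2
        ring_nf at this ⊢; exact this
    unfold IsZigzagChord at hab hab'
    exact key _ (by omega) (by omega) (hs _ _ hsum)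
  · rcases Sym2.eq_iff.1 h' with ⟨e1, -⟩ | ⟨-, e1⟩ <;> exact W.ne_center _ e1
  · rcases Sym2.eq_iff.1 h' with ⟨e1, -⟩ | ⟨e1, -⟩ <;> exact W.ne_center _ e1.symm
  · have e1 : f (3 * t * (h + 1) + z) = f (3 * t' * (h + 1) + z') := by
      rcases Sym2.eq_iff.1 h' with ⟨-, e1⟩ | ⟨e1, -⟩
      · exact e1
      · exact absurd e1.symm (W.ne_center _)
    rw [W.eq_iff] at e1
    have h3 := hs (2 * z) (2 * z') (by
      have := dvd_mul_of_dvd_right e1 2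
      ring_nf at this ⊢; exact this)
    have shift : ∀ d k, 2 * z - 2 * z' = d + m * k → -2 ≤ d → d ≤ 2 → False := by
      intro d k hd h4 h5
      refine key d h4 h5 ?_
      have e : 3 * (t - t') + d = 3 * (t - t') + (2 * z - 2 * z') - m * k := by linarith
      rw [e]
      exact dvd_sub h3 (dvd_mul_right _ _)
    rcases hz with rfl | rfl <;> rcases hz' with rfl | rfl <;> rcases hL with hL | hL
    · exact shift 0 0 (by omega) (by omega) (by omega)
    · exact shift 0 0 (by omega) (by omega) (by omega)
    · exact shift (-1) 1 (by omega) (by omega) (by omega)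
    · exact shift 1 1 (by omega) (by omega) (by omega)
    · exact shift 1 (-1) (by omega) (by omega) (by omega)
    · exact shift (-1) (-1) (by omega) (by omega) (by omega)
    · exact shift 0 0 (by omega) (by omega) (by omega)
    · exact shift 0 0 (by omega) (by omega) (by omega)

theorem hasOnePHCPacking (W : IsWheelLabelling m c f) (hm : 3 < m)
    (hcard : (P.card : ℤ) = m + 1) {k : ℕ} (hk : 3 * (k : ℤ) ≤ m) : HasOnePHCPacking P k := by
  obtain ⟨h, hh⟩ := W.odd
  obtain ⟨i, hL⟩ : ∃ i, 2 * i + 1 = h ∨ 2 * i = h := ⟨h / 2, by omega⟩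
  refine ⟨fun t => zigzagCycle c f h i (3 * (t : ℕ) * (h + 1)), fun t =>
    ⟨W.isHamCycleGraph_zigzagCycle hh hcard (by omega) (by omega),
      W.isOnePlane_zigzagCycle hh (by omega) (by omega) hL⟩, fun t t' hne => ?_⟩
  have := t.isLt
  have := t'.isLt
  exact W.disjoint_zigzagCycle hh (by omega) (by omega) hL
    (fun e => hne (Fin.ext (by exact_mod_cast e))) (by omega) (by omega)

end IsWheelLabelling

end Zigzag

theorem theorem2 (n : ℕ) (hn : 10 ≤ n) (heven : Even n)
    (P : Finset ℂ) (hP : IsRegularWheel n P) :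
    IsGreatest {k : ℕ | HasOnePHCPacking P k} ((n - 1) / 3) := by
  obtain ⟨c, f, W⟩ := hP.exists_labelling (by omega) heven
  refine ⟨W.hasOnePHCPacking (by omega) ?_ (by omega), fun k hk => ?_⟩
  · rw [hP.1]; ring
  · have := W.packing_le (by omega) hk
    omega
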